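/- Let $k\ge 2$ and let $C_1,\dots,C_k\subset\mathbb{P}^2_{\mathbb{C}}$ be pairwise distinct smooth conics, with equations $q_1,\dots,q_k\in S=\mathbb{C}[x,y,z]$, and let $f=q_1\cdots q_k$ be the equation of the curve $C=C_1\cup\dots\cup C_k$. Assume that every singular point of $C$ is a node, a tacnode, an ordinary triple point or an ordinary quadruple point; that is, the germ of $C$ at each of its singular points consists either of exactly $m\in\{2,3,4\}$ smooth branches that meet pairwise transversally, or of exactly two smooth branches that meet with intersection multiplicity $2$. Then $C$ is not free: if $J_f=\langle\partial_xf,\partial_yf,\partial_zf\rangle$ is the Jacobian ideal of $f$ and $I_f$ is its saturation with respect to $\langle x,y,z\rangle$, then $N(f)=I_f/J_f\neq 0$. -/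

import Mathlib

open MvPolynomial

/-! ### Free plane curves

`S = ℂ[x, y, z]` is `MvPolynomial (Fin 3) ℂ`; points of `ℙ²(ℂ)` are given by their homogeneous
coordinates, i.e. by nonzero vectors of `Fin 3 → ℂ`. -/

noncomputable section

/-- The Jacobian ideal `J_f = ⟨∂f/∂x, ∂f/∂y, ∂f/∂z⟩` of `f ∈ ℂ[x, y, z]`. -/
def jacobianIdeal (f : MvPolynomial (Fin 3) ℂ) : Ideal (MvPolynomial (Fin 3) ℂ) :=
  Ideal.span (Set.range fun i : Fin 3 => pderiv i f)

/-- The irrelevant ideal `𝔪 = ⟨x, y, z⟩` of `ℂ[x, y, z]`. -/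
def irrelevantIdeal : Ideal (MvPolynomial (Fin 3) ℂ) :=
  Ideal.span (Set.range fun i : Fin 3 => (X i : MvPolynomial (Fin 3) ℂ))

/-- The saturation `⋃ₙ (I : 𝔪ⁿ)` of an ideal with respect to the irrelevant ideal. The union is
increasing in `n`, so that it is the supremum of the ideals `(I : 𝔪ⁿ)`. -/
def idealSaturation (I : Ideal (MvPolynomial (Fin 3) ℂ)) : Ideal (MvPolynomial (Fin 3) ℂ) :=
  ⨆ n : ℕ, I.colon ((irrelevantIdeal ^ n : Ideal (MvPolynomial (Fin 3) ℂ)) :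
    Set (MvPolynomial (Fin 3) ℂ))

/-- The module `N(f) = I_f / J_f`, where `I_f` is the saturation of the Jacobian ideal `J_f`. -/
abbrev jacobianModule (f : MvPolynomial (Fin 3) ℂ) : Type :=
  ↥(idealSaturation (jacobianIdeal f)) ⧸
    (jacobianIdeal f).submoduleOf (idealSaturation (jacobianIdeal f))

/-- The plane curve `f = 0` is free: `N(f) = 0`. -/
def IsFreeCurve (f : MvPolynomial (Fin 3) ℂ) : Prop :=
  Subsingleton (jacobianModule f)

/-! ### Singularities of plane curves -/

/-- The point of `ℙ²` with homogeneous coordinates `v` is a singular point of `f = 0`. -/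
def IsSingularPoint (f : MvPolynomial (Fin 3) ℂ) (v : Fin 3 → ℂ) : Prop :=
  v ≠ 0 ∧ eval v f = 0 ∧ ∀ i : Fin 3, eval v (pderiv i f) = 0

/-- The dehomogenization `f(v + s a + t b) ∈ ℂ[s, t]` of `f`. If `a, b, v` is a basis of `ℂ³`, then
`s, t` are affine coordinates of `ℙ²` centred at the point `v`, and this is the local equation of
the curve `f = 0` at that point. -/
def localEquation (f : MvPolynomial (Fin 3) ℂ) (v a b : Fin 3 → ℂ) : MvPolynomial (Fin 2) ℂ :=
  aeval (fun i : Fin 3 => C (v i) + C (a i) * X 0 + C (b i) * X 1) f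

/-- The intersection multiplicity `dim ℂ⟦s, t⟧ / (g, h)` at the origin of two curve germs. -/
def germIntersection (g h : MvPowerSeries (Fin 2) ℂ) : ℕ :=
  Module.finrank ℂ (MvPowerSeries (Fin 2) ℂ ⧸ Ideal.span {g, h})

/-- The curve germ `F = 0` at the origin consists of exactly `m` branches, all of them smooth, any
two of which meet with intersection multiplicity `μ`. (A power series defines a smooth branch
exactly if it has order one; for `m ≥ 1` a unit factor of `F` can be absorbed in a branch.) -/
def HasSmoothBranches (F : MvPowerSeries (Fin 2) ℂ) (m μ : ℕ) : Prop :=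
  ∃ g : Fin m → MvPowerSeries (Fin 2) ℂ,
    F = ∏ i, g i ∧ (∀ i, (g i).order = 1) ∧ ∀ i j, i ≠ j → germIntersection (g i) (g j) = μ

/-- At the point `v`, the curve `f = 0` consists of exactly `m` smooth branches, any two of which
meet with intersection multiplicity `μ`. -/
def HasSmoothBranchesAt (f : MvPolynomial (Fin 3) ℂ) (v : Fin 3 → ℂ) (m μ : ℕ) : Prop :=
  ∃ a b : Fin 3 → ℂ, LinearIndependent ℂ ![a, b, v] ∧
    HasSmoothBranches (localEquation f v a b : MvPowerSeries (Fin 2) ℂ) m μ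

/-- An ordinary point of multiplicity `m`: there are `m` smooth branches, and they meet pairwise
transversally. -/
def IsOrdinaryPoint (f : MvPolynomial (Fin 3) ℂ) (v : Fin 3 → ℂ) (m : ℕ) : Prop :=
  HasSmoothBranchesAt f v m 1

/-- A node: two smooth branches that meet transversally. -/
def IsNode (f : MvPolynomial (Fin 3) ℂ) (v : Fin 3 → ℂ) : Prop :=
  IsOrdinaryPoint f v 2

/-- A tacnode: two smooth branches that meet with intersection multiplicity two. -/
def IsTacnode (f : MvPolynomial (Fin 3) ℂ) (v : Fin 3 → ℂ) : Prop :=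
  HasSmoothBranchesAt f v 2 2

/-! ### Conic arrangements -/

/-- `q = 0` is a smooth conic. -/
def IsSmoothConic (q : MvPolynomial (Fin 3) ℂ) : Prop :=
  q.IsHomogeneous 2 ∧ ∀ v : Fin 3 → ℂ, ¬ IsSingularPoint q v

/-- The `k` curves `Q i = 0` are pairwise distinct smooth conics, and every singular point of their
union is a node, a tacnode, an ordinary triple point or an ordinary quadruple point. -/
structure IsQConicArrangement {k : ℕ} (Q : Fin k → MvPolynomial (Fin 3) ℂ) : Prop where
  two_le : 2 ≤ k
  smooth : ∀ i, IsSmoothConic (Q i)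
  distinct : ∀ i j, i ≠ j → ¬ Associated (Q i) (Q j)
  singularities : ∀ v : Fin 3 → ℂ, IsSingularPoint (∏ i, Q i) v →
    IsNode (∏ i, Q i) v ∨ IsTacnode (∏ i, Q i) v ∨
      IsOrdinaryPoint (∏ i, Q i) v 3 ∨ IsOrdinaryPoint (∏ i, Q i) v 4

end

/-! The argument plays a lower bound for the total Tjurina number of a free curve against an upper
bound coming from Bézout's theorem; the two miss each other by one.

Lower bound. Write k = m + 2, so that f has degree 2m + 4 and its partial derivatives have degree 2m
+ 3. If the curve is free, J_f is saturated, so a form of degree 3m + 3 that lies in J_f locally at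
every singular point lies in J_f (`mem_idealSaturation_of_forall`). Hence the forms of degree 3m + 3
modulo J_f embed into the product of the local algebras. In that degree J_f is the image of three
copies of the forms of degree m, so the quotient has dimension at least C(3m+5, 2) - 3 C(m+2, 2) =
3(m+2)(m+1) + 1 (`lt_sum_colength_of_isFreeCurve`).

Upper bound. At a singular point p let c(p) be the sum over ordered pairs of distinct conics of
their contact order, truncated at two. The local inequality is 4τ(p) ≤ 3c(p)
(`IsQConicArrangement.exists_colength`): the typical pairs (τ, c) are (1, 2) for a node, (3, 4) for
a tacnode, (4, 6) for a triple point and (9, 12) for a quadruple point, with equality for tacnodes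
and quadruple points. By Bézout the c(p) add up to at most 4k(k-1) (`sum_meetOrder_le`), so the sum
of the τ(p) is at most 3k(k-1) = 3(m+2)(m+1).

Only upper bounds for the τ(p) are needed. They are computed in ℂ⟦s, t⟧ from explicit
factorizations, and Krull's theorem carries membership in the completed ideal back to polynomials.
-/

/-! ### Colength bounds for Jacobian ideals in terms of local parameters. -/

section LocalAlgebra

variable {R : Type*} [CommRing R] [Algebra ℂ R]

/-- The quotient `R ⧸ J` is spanned over `ℂ` by `n` elements. -/
def HasColengthLE (J : Ideal R) (n : ℕ) : Prop :=
  ∃ b : Fin n → R, ∀ r : R, r ∈ Submodule.span ℂ (Set.range b) ⊔ J.restrictScalars ℂ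

theorem HasColengthLE.finite_and_finrank_le {J : Ideal R} {n : ℕ} (h : HasColengthLE J n) :
    Module.Finite ℂ (R ⧸ J) ∧ Module.finrank ℂ (R ⧸ J) ≤ n := by
  obtain ⟨b, hb⟩ := h
  let c : Fin n → R ⧸ J := fun i => Ideal.Quotient.mkₐ ℂ J (b i)
  have hc : Submodule.span ℂ (Set.range c) = ⊤ := by
    rw [eq_top_iff]
    rintro z -
    obtain ⟨r, rfl⟩ := Ideal.Quotient.mk_surjective z
    obtain ⟨u, hu, v, hv, rfl⟩ := Submodule.mem_sup.1 (hb r)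
    have hv0 : Ideal.Quotient.mk J v = 0 := Ideal.Quotient.eq_zero_iff_mem.2 hv
    rw [map_add, hv0, add_zero]
    have : Submodule.map (Ideal.Quotient.mkₐ ℂ J).toLinearMap (Submodule.span ℂ (Set.range b)) =
        Submodule.span ℂ (Set.range c) := by
      rw [Submodule.map_span, ← Set.range_comp]; rfl
    rw [← this]
    exact ⟨u, hu, rfl⟩
  refine ⟨⟨Submodule.fg_def.2 ⟨_, Set.finite_range c, hc⟩⟩, ?_⟩
  have := finrank_range_le_card (R := ℂ) c
  rw [Set.finrank, hc, finrank_top, Fintype.card_fin] at this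
  exact this

theorem natCast_isUnit (n : ℕ) (hn : n ≠ 0) : IsUnit (n : R) := by
  have : (n : R) = algebraMap ℂ R n := by simp
  rw [this]
  exact (IsUnit.mk0 (n : ℂ) (by exact_mod_cast hn)).map _

variable [IsLocalRing R]

/-- Local parameters `x, y` of a local ring with residue field `ℂ`, with dual derivations. -/
structure IsParameterSystem (x y : R) (D₁ D₂ : Derivation ℂ R R) : Prop where
  residue : ∀ r : R, ∃ c : ℂ, r - algebraMap ℂ R c ∈ IsLocalRing.maximalIdeal R
  maximal : IsLocalRing.maximalIdeal R = Ideal.span {x, y}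
  D₁x : D₁ x = 1
  D₁y : D₁ y = 0
  D₂x : D₂ x = 0
  D₂y : D₂ y = 1

namespace IsParameterSystem

variable {x y : R} {D₁ D₂ : Derivation ℂ R R}

/-- Since R = ℂ + (x, y), the ideal gR is ℂg + xgR + ygR. Used by descending degree, this shows that
a space W spanned by J and a few monomials is all of R. -/
theorem mul_mem_of_mem (h : IsParameterSystem x y D₁ D₂) {W : Submodule ℂ R} {g : R} (hg : g ∈ W)
    (hx : ∀ s, x * g * s ∈ W) (hy : ∀ s, y * g * s ∈ W) (s : R) : g * s ∈ W := by
  obtain ⟨c, hc⟩ := h.residue s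
  rw [h.maximal, Ideal.mem_span_pair] at hc
  obtain ⟨u, v, huv⟩ := hc
  have : g * s = c • g + x * g * u + y * g * v := by
    rw [Algebra.smul_def]; linear_combination g * (-huv)
  rw [this]
  exact W.add_mem (W.add_mem (W.smul_mem _ hg) (hx _)) (hy _)

/-- Nakayama's lemma for an ideal generated by a finite set. -/
theorem span_le_of_subset (h : IsParameterSystem x y D₁ D₂) {J : Ideal R} (s : Finset R)
    (hs : ∀ N : Ideal R, J ≤ N → (∀ g ∈ s, x * g ∈ N ∧ y * g ∈ N) → ∀ g ∈ s, g ∈ N) :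
    ∀ g ∈ s, g ∈ J := by
  have key : Ideal.span (s : Set R) ≤ J := by
    -- The hypothesis is applied to N = J + 𝔪(s), so relations among the elements of `s` need only
    -- be checked modulo J and terms of the next order.
    refine Submodule.le_of_le_smul_of_le_jacobson_bot (I := IsLocalRing.maximalIdeal R)
      ⟨s, rfl⟩ (IsLocalRing.maximalIdeal_le_jacobson _) (Ideal.span_le.2 ?_)
    refine hs _ le_sup_left fun g hg => ?_
    have hg' : g ∈ Ideal.span (s : Set R) := Ideal.subset_span hg
    constructor
    · exact Submodule.mem_sup_right (Submodule.smul_mem_smul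
        (by rw [h.maximal]; exact Ideal.subset_span (by simp)) hg')
    · exact Submodule.mem_sup_right (Submodule.smul_mem_smul
        (by rw [h.maximal]; exact Ideal.subset_span (by simp)) hg')
  exact fun g hg => key (Ideal.subset_span hg)

theorem node (h : IsParameterSystem x y D₁ D₂) {J : Ideal R}
    (h₁ : D₁ (x * y) ∈ J) (h₂ : D₂ (x * y) ∈ J) : HasColengthLE J 1 := by
  have hy : y ∈ J := by simpa [h.D₁x, h.D₁y] using h₁
  have hx : x ∈ J := by simpa [h.D₂x, h.D₂y] using h₂
  refine ⟨![1], fun r => ?_⟩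
  rw [← one_mul r]
  refine h.mul_mem_of_mem (Submodule.mem_sup_left (Submodule.subset_span (Set.mem_range_self 0)))
    ?_ ?_ r
  · exact fun s => Submodule.mem_sup_right (J.mul_mem_right _ (J.mul_mem_right _ hx))
  · exact fun s => Submodule.mem_sup_right (J.mul_mem_right _ (J.mul_mem_right _ hy))

/-- The ideal contains xy, x² and y³, which leaves 1, x, y, y²; the derivative along x then
expresses x through y². The germ itself is assumed to lie in J because it yields x² at once. -/
theorem tacnode (h : IsParameterSystem x y D₁ D₂) {J : Ideal R} {a b : R} (ha : IsUnit a)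
    (hb : IsUnit b) (h₀ : x * (a * x + b * y ^ 2) ∈ J)
    (h₁ : D₁ (x * (a * x + b * y ^ 2)) ∈ J)
    (h₂ : D₂ (x * (a * x + b * y ^ 2)) ∈ J) : HasColengthLE J 3 := by
  have e₁ : D₁ (x * (a * x + b * y ^ 2)) =
      2 * a * x + b * y ^ 2 + D₁ a * x ^ 2 + D₁ b * x * y ^ 2 := by
    simp [h.D₁x, h.D₁y, Derivation.leibniz_pow]; ring
  have e₂ : D₂ (x * (a * x + b * y ^ 2)) =
      2 * b * (x * y) + D₂ a * x ^ 2 + D₂ b * x * y ^ 2 := by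
    simp [h.D₂x, h.D₂y, Derivation.leibniz_pow]; ring
  rw [e₁] at h₁
  rw [e₂] at h₂
  have u2 : IsUnit (2 : R) := natCast_isUnit 2 two_ne_zero
  classical
  have hI : ∀ g ∈ ({x * y, y ^ 3, x ^ 2} : Finset R), g ∈ J := by
    refine h.span_le_of_subset _ fun N hJ hN => ?_
    simp only [Finset.mem_insert, Finset.mem_singleton, forall_eq_or_imp, forall_eq] at hN ⊢
    obtain ⟨⟨n1, n2⟩, ⟨n3, n4⟩, n5, n6⟩ := hN
    have hx2 : x ^ 2 ∈ N := by
      rw [← Ideal.unit_mul_mem_iff_mem N ha]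
      have : a * x ^ 2 = x * (a * x + b * y ^ 2) - b * (y * (x * y)) := by ring
      rw [this]
      exact N.sub_mem (hJ h₀) (N.mul_mem_left _ n2)
    have hxy : x * y ∈ N := by
      rw [← Ideal.unit_mul_mem_iff_mem N (u2.mul hb)]
      have : 2 * b * (x * y) = (2 * b * (x * y) + D₂ a * x ^ 2 + D₂ b * x * y ^ 2)
        - D₂ a * x ^ 2 - D₂ b * (y * (x * y)) := by ring
      rw [this]
      exact N.sub_mem (N.sub_mem (hJ h₂) (N.mul_mem_left _ hx2)) (N.mul_mem_left _ n2)
    refine ⟨hxy, ?_, hx2⟩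
    rw [← Ideal.unit_mul_mem_iff_mem N hb]
    have : b * y ^ 3 = y * (2 * a * x + b * y ^ 2 + D₁ a * x ^ 2 + D₁ b * x * y ^ 2)
      - (2 * a + D₁ a * x + D₁ b * y ^ 2) * (x * y) := by ring
    rw [this]
    exact N.sub_mem (N.mul_mem_left _ (hJ h₁)) (N.mul_mem_left _ hxy)
  simp only [Finset.mem_insert, Finset.mem_singleton, forall_eq_or_imp, forall_eq] at hI
  obtain ⟨hxy, hy3, hx2⟩ := hI
  refine ⟨![1, y, y ^ 2], fun r => ?_⟩
  set W := Submodule.span ℂ (Set.range ![1, y, y ^ 2]) ⊔ J.restrictScalars ℂ with hW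
  have w0 : (1 : R) ∈ W := Submodule.mem_sup_left (Submodule.subset_span ⟨0, rfl⟩)
  have w1 : y ∈ W := Submodule.mem_sup_left (Submodule.subset_span ⟨1, rfl⟩)
  have w2 : y ^ 2 ∈ W := Submodule.mem_sup_left (Submodule.subset_span ⟨2, rfl⟩)
  have hJW : ∀ z ∈ J, z ∈ W := fun z hz => Submodule.mem_sup_right hz
  have wy2 : ∀ s, y ^ 2 * s ∈ W := by
    refine h.mul_mem_of_mem w2 (fun s => hJW _ ?_) (fun s => hJW _ ?_)
    · have : x * y ^ 2 * s = y * s * (x * y) := by ring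
      rw [this]; exact J.mul_mem_left _ hxy
    · have : y * y ^ 2 * s = s * y ^ 3 := by ring
      rw [this]; exact J.mul_mem_left _ hy3
  have wx : ∀ s, x * s ∈ W := by
    intro s
    obtain ⟨v, hv⟩ := (u2.mul ha).exists_right_inv
    have : x * s = v * s * (2 * a * x + b * y ^ 2 + D₁ a * x ^ 2 + D₁ b * x * y ^ 2)
      - (v * s * D₁ a) * x ^ 2 - (v * s * D₁ b * y) * (x * y) + y ^ 2 * (-(v * s * b)) := by
      linear_combination (-(x * s)) * hv
    rw [this]
    exact W.add_mem (W.sub_mem (W.sub_mem (hJW _ (J.mul_mem_left _ h₁))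
      (hJW _ (J.mul_mem_left _ hx2))) (hJW _ (J.mul_mem_left _ hxy))) (wy2 _)
  have wy : ∀ s, y * s ∈ W := by
    refine h.mul_mem_of_mem w1 (fun s => ?_) (fun s => ?_)
    · rw [mul_assoc]; exact wx _
    · rw [← pow_two]; exact wy2 _
  rw [← one_mul r]
  refine h.mul_mem_of_mem w0 (fun s => ?_) (fun s => ?_) r
  · rw [mul_assoc]; exact wx _
  · rw [mul_assoc]; exact wy _

/-- The products of x, y with the two partials give four relations among the four cubic monomials,
solvable because a, b and 3 are units. So J contains all cubics, and the two partials eliminate x²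
and y² in favour of xy. -/
theorem triplePoint (h : IsParameterSystem x y D₁ D₂) {J : Ideal R} {a b : R} (ha : IsUnit a)
    (hb : IsUnit b) (h₁ : D₁ (x * y * (a * x + b * y)) ∈ J)
    (h₂ : D₂ (x * y * (a * x + b * y)) ∈ J) : HasColengthLE J 4 := by
  have e₁ : D₁ (x * y * (a * x + b * y)) =
      2 * a * (x * y) + b * y ^ 2 + D₁ a * (x ^ 2 * y) + D₁ b * (x * y ^ 2) := by
    simp [h.D₁x, h.D₁y]; ring
  have e₂ : D₂ (x * y * (a * x + b * y)) =
      a * x ^ 2 + 2 * b * (x * y) + D₂ a * (x ^ 2 * y) + D₂ b * (x * y ^ 2) := by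
    simp [h.D₂x, h.D₂y]; ring
  rw [e₁] at h₁
  rw [e₂] at h₂
  have u3 : IsUnit (3 : R) := natCast_isUnit 3 three_ne_zero
  classical
  have hI : ∀ g ∈ ({x ^ 3, x ^ 2 * y, x * y ^ 2, y ^ 3} : Finset R), g ∈ J := by
    refine h.span_le_of_subset _ fun N hJ hN => ?_
    simp only [Finset.mem_insert, Finset.mem_singleton, forall_eq_or_imp, forall_eq] at hN ⊢
    obtain ⟨⟨n1, n2⟩, ⟨n3, n4⟩, ⟨n5, n6⟩, n7, n8⟩ := hN
    replace h₁ := hJ h₁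
    replace h₂ := hJ h₂
    have r1 : 2 * a * (x ^ 2 * y) + b * (x * y ^ 2) ∈ N := by
      convert N.sub_mem (N.mul_mem_left x h₁)
        (N.add_mem (N.mul_mem_left (D₁ a) n3) (N.mul_mem_left (D₁ b) n5)) using 1
      ring
    have r2 : 2 * a * (x * y ^ 2) + b * y ^ 3 ∈ N := by
      convert N.sub_mem (N.mul_mem_left y h₁)
        (N.add_mem (N.mul_mem_left (D₁ a) n4) (N.mul_mem_left (D₁ b) n6)) using 1
      ring
    have r3 : a * x ^ 3 + 2 * b * (x ^ 2 * y) ∈ N := by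
      convert N.sub_mem (N.mul_mem_left x h₂)
        (N.add_mem (N.mul_mem_left (D₂ a) n3) (N.mul_mem_left (D₂ b) n5)) using 1
      ring
    have r4 : a * (x ^ 2 * y) + 2 * b * (x * y ^ 2) ∈ N := by
      convert N.sub_mem (N.mul_mem_left y h₂)
        (N.add_mem (N.mul_mem_left (D₂ a) n4) (N.mul_mem_left (D₂ b) n6)) using 1
      ring
    have m2 : x ^ 2 * y ∈ N := by
      rw [← Ideal.unit_mul_mem_iff_mem N (u3.mul ha)]
      convert N.sub_mem (N.mul_mem_left 2 r1) r4 using 1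
      ring
    have m3 : x * y ^ 2 ∈ N := by
      rw [← Ideal.unit_mul_mem_iff_mem N hb]
      convert N.sub_mem r1 (N.mul_mem_left (2 * a) m2) using 1
      ring
    have m1 : x ^ 3 ∈ N := by
      rw [← Ideal.unit_mul_mem_iff_mem N ha]
      convert N.sub_mem r3 (N.mul_mem_left (2 * b) m2) using 1
      ring
    have m4 : y ^ 3 ∈ N := by
      rw [← Ideal.unit_mul_mem_iff_mem N hb]
      convert N.sub_mem r2 (N.mul_mem_left (2 * a) m3) using 1
      ring
    exact ⟨m1, m2, m3, m4⟩
  simp only [Finset.mem_insert, Finset.mem_singleton, forall_eq_or_imp, forall_eq] at hI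
  obtain ⟨m1, m2, m3, m4⟩ := hI
  refine ⟨![1, x, y, x * y], fun r => ?_⟩
  set W := Submodule.span ℂ (Set.range ![1, x, y, x * y]) ⊔ J.restrictScalars ℂ with hW
  have w0 : (1 : R) ∈ W := Submodule.mem_sup_left (Submodule.subset_span ⟨0, rfl⟩)
  have w1 : x ∈ W := Submodule.mem_sup_left (Submodule.subset_span ⟨1, rfl⟩)
  have w2 : y ∈ W := Submodule.mem_sup_left (Submodule.subset_span ⟨2, rfl⟩)
  have w3 : x * y ∈ W := Submodule.mem_sup_left (Submodule.subset_span ⟨3, rfl⟩)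
  have hJW : ∀ z ∈ J, z ∈ W := fun z hz => Submodule.mem_sup_right hz
  have wxy : ∀ s, x * y * s ∈ W := by
    refine h.mul_mem_of_mem w3 (fun s => hJW _ ?_) (fun s => hJW _ ?_)
    · convert J.mul_mem_left s m2 using 1; ring
    · convert J.mul_mem_left s m3 using 1; ring
  have wx2 : ∀ s, x ^ 2 * s ∈ W := by
    intro s
    obtain ⟨v, hv⟩ := ha.exists_right_inv
    have : x ^ 2 * s = x * y * (-(2 * b * v * s)) + (v * s) *
        ((a * x ^ 2 + 2 * b * (x * y) + D₂ a * (x ^ 2 * y) + D₂ b * (x * y ^ 2))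
          - D₂ a * (x ^ 2 * y) - D₂ b * (x * y ^ 2)) := by
      linear_combination (-(x ^ 2 * s)) * hv
    rw [this]
    exact W.add_mem (wxy _) (hJW _ (J.mul_mem_left _ (J.sub_mem (J.sub_mem h₂
      (J.mul_mem_left _ m2)) (J.mul_mem_left _ m3))))
  have wy2 : ∀ s, y ^ 2 * s ∈ W := by
    intro s
    obtain ⟨v, hv⟩ := hb.exists_right_inv
    have : y ^ 2 * s = x * y * (-(2 * a * v * s)) + (v * s) *
        ((2 * a * (x * y) + b * y ^ 2 + D₁ a * (x ^ 2 * y) + D₁ b * (x * y ^ 2))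
          - D₁ a * (x ^ 2 * y) - D₁ b * (x * y ^ 2)) := by
      linear_combination (-(y ^ 2 * s)) * hv
    rw [this]
    exact W.add_mem (wxy _) (hJW _ (J.mul_mem_left _ (J.sub_mem (J.sub_mem h₁
      (J.mul_mem_left _ m2)) (J.mul_mem_left _ m3))))
  have wx : ∀ s, x * s ∈ W := by
    refine h.mul_mem_of_mem w1 (fun s => ?_) (fun s => ?_)
    · rw [← pow_two]; exact wx2 _
    · rw [mul_comm y]; exact wxy _
  have wy : ∀ s, y * s ∈ W := by
    refine h.mul_mem_of_mem w2 (fun s => ?_) (fun s => ?_)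
    · exact wxy _
    · rw [← pow_two]; exact wy2 _
  rw [← one_mul r]
  refine h.mul_mem_of_mem w0 (fun s => ?_) (fun s => ?_) r
  · rw [mul_assoc]; exact wx _
  · rw [mul_assoc]; exact wy _

/-- The products of x², xy, y² with the two partials give six relations among the six quintic
monomials; their determinant is a unit because the discriminant b² - 4ac is one. So J contains all
quintics. Below that degree the relations eliminate x³y, xy³, x³ and y³, leaving nine monomials. -/
theorem quadruplePoint (h : IsParameterSystem x y D₁ D₂) {J : Ideal R} {a b c : R} (ha : IsUnit a)
    (hc : IsUnit c) (hd : IsUnit (b ^ 2 - 4 * a * c))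
    (h₁ : D₁ (x * y * (a * x ^ 2 + b * (x * y) + c * y ^ 2)) ∈ J)
    (h₂ : D₂ (x * y * (a * x ^ 2 + b * (x * y) + c * y ^ 2)) ∈ J) : HasColengthLE J 9 := by
  have e₁ : D₁ (x * y * (a * x ^ 2 + b * (x * y) + c * y ^ 2)) =
      3 * a * (x ^ 2 * y) + 2 * b * (x * y ^ 2) + c * y ^ 3 +
        x * y * (D₁ a * x ^ 2 + D₁ b * (x * y) + D₁ c * y ^ 2) := by
    simp [h.D₁x, h.D₁y, Derivation.leibniz_pow]; ring
  have e₂ : D₂ (x * y * (a * x ^ 2 + b * (x * y) + c * y ^ 2)) =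
      a * x ^ 3 + 2 * b * (x ^ 2 * y) + 3 * c * (x * y ^ 2) +
        x * y * (D₂ a * x ^ 2 + D₂ b * (x * y) + D₂ c * y ^ 2) := by
    simp [h.D₂x, h.D₂y, Derivation.leibniz_pow]; ring
  rw [e₁] at h₁
  rw [e₂] at h₂
  generalize D₁ a = a₁ at *
  generalize D₁ b = b₁ at *
  generalize D₁ c = c₁ at *
  generalize D₂ a = a₂ at *
  generalize D₂ b = b₂ at *
  generalize D₂ c = c₂ at *
  have u2 : IsUnit (2 : R) := natCast_isUnit 2 two_ne_zero
  have u4 : IsUnit (4 : R) := natCast_isUnit 4 four_ne_zero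
  have u3 : IsUnit (3 : R) := natCast_isUnit 3 three_ne_zero
  classical
  have hI : ∀ g ∈ ({x ^ 5, x ^ 4 * y, x ^ 3 * y ^ 2, x ^ 2 * y ^ 3, x * y ^ 4, y ^ 5} : Finset R),
      g ∈ J := by
    refine h.span_le_of_subset _ fun N hJ hN => ?_
    simp only [Finset.mem_insert, Finset.mem_singleton, forall_eq_or_imp, forall_eq] at hN ⊢
    obtain ⟨-, ⟨n1, n2⟩, ⟨n3, n4⟩, ⟨n5, n6⟩, ⟨n7, n8⟩, -⟩ := hN
    replace h₁ := hJ h₁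
    replace h₂ := hJ h₂
    have r1 : 3 * a * (x ^ 4 * y) + 2 * b * (x ^ 3 * y ^ 2) + c * (x ^ 2 * y ^ 3) ∈ N := by
      convert N.sub_mem (N.mul_mem_left (x ^ 2) h₁) (N.add_mem (N.add_mem (N.mul_mem_left a₁ n1)
        (N.mul_mem_left b₁ n3)) (N.mul_mem_left c₁ n5)) using 1
      ring
    have r2 : 3 * a * (x ^ 3 * y ^ 2) + 2 * b * (x ^ 2 * y ^ 3) + c * (x * y ^ 4) ∈ N := by
      convert N.sub_mem (N.mul_mem_left (x * y) h₁) (N.add_mem (N.add_mem (N.mul_mem_left a₁ n3)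
        (N.mul_mem_left b₁ n5)) (N.mul_mem_left c₁ n7)) using 1
      ring
    have r3 : 3 * a * (x ^ 2 * y ^ 3) + 2 * b * (x * y ^ 4) + c * y ^ 5 ∈ N := by
      convert N.sub_mem (N.mul_mem_left (y ^ 2) h₁) (N.add_mem (N.add_mem (N.mul_mem_left a₁ n5)
        (N.mul_mem_left b₁ n7)) (N.mul_mem_left c₁ n8)) using 1
      ring
    have r4 : a * x ^ 5 + 2 * b * (x ^ 4 * y) + 3 * c * (x ^ 3 * y ^ 2) ∈ N := by
      convert N.sub_mem (N.mul_mem_left (x ^ 2) h₂) (N.add_mem (N.add_mem (N.mul_mem_left a₂ n1)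
        (N.mul_mem_left b₂ n3)) (N.mul_mem_left c₂ n5)) using 1
      ring
    have r5 : a * (x ^ 4 * y) + 2 * b * (x ^ 3 * y ^ 2) + 3 * c * (x ^ 2 * y ^ 3) ∈ N := by
      convert N.sub_mem (N.mul_mem_left (x * y) h₂) (N.add_mem (N.add_mem (N.mul_mem_left a₂ n3)
        (N.mul_mem_left b₂ n5)) (N.mul_mem_left c₂ n7)) using 1
      ring
    have r6 : a * (x ^ 3 * y ^ 2) + 2 * b * (x ^ 2 * y ^ 3) + 3 * c * (x * y ^ 4) ∈ N := by
      convert N.sub_mem (N.mul_mem_left (y ^ 2) h₂) (N.add_mem (N.add_mem (N.mul_mem_left a₂ n5)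
        (N.mul_mem_left b₂ n7)) (N.mul_mem_left c₂ n8)) using 1
      ring
    -- Eliminating x⁴y and xy⁴ leaves a 2 × 2 system for x³y² and x²y³ with determinant ±(b² - 4ac).
    have s1 : 4 * (b * (x ^ 3 * y ^ 2) + 2 * c * (x ^ 2 * y ^ 3)) ∈ N := by
      convert N.sub_mem (N.mul_mem_left 3 r5) r1 using 1
      ring
    have s2 : 4 * (2 * a * (x ^ 3 * y ^ 2) + b * (x ^ 2 * y ^ 3)) ∈ N := by
      convert N.sub_mem (N.mul_mem_left 3 r2) r6 using 1
      ring
    rw [Ideal.unit_mul_mem_iff_mem N u4] at s1 s2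
    have m4 : x ^ 2 * y ^ 3 ∈ N := by
      rw [← Ideal.unit_mul_mem_iff_mem N hd]
      convert N.sub_mem (N.mul_mem_left b s2) (N.mul_mem_left (2 * a) s1) using 1
      ring
    have m3 : x ^ 3 * y ^ 2 ∈ N := by
      rw [← Ideal.unit_mul_mem_iff_mem N hd]
      convert N.sub_mem (N.mul_mem_left b s1) (N.mul_mem_left (2 * c) s2) using 1
      ring
    have m2 : x ^ 4 * y ∈ N := by
      rw [← Ideal.unit_mul_mem_iff_mem N ha]
      convert N.sub_mem r5 (N.add_mem (N.mul_mem_left (2 * b) m3) (N.mul_mem_left (3 * c) m4))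
        using 1
      ring
    have m5 : x * y ^ 4 ∈ N := by
      rw [← Ideal.unit_mul_mem_iff_mem N hc]
      convert N.sub_mem r2 (N.add_mem (N.mul_mem_left (2 * b) m4) (N.mul_mem_left (3 * a) m3))
        using 1
      ring
    have m1 : x ^ 5 ∈ N := by
      rw [← Ideal.unit_mul_mem_iff_mem N ha]
      convert N.sub_mem r4 (N.add_mem (N.mul_mem_left (2 * b) m2) (N.mul_mem_left (3 * c) m3))
        using 1
      ring
    have m6 : y ^ 5 ∈ N := by
      rw [← Ideal.unit_mul_mem_iff_mem N hc]
      convert N.sub_mem r3 (N.add_mem (N.mul_mem_left (2 * b) m5) (N.mul_mem_left (3 * a) m4))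
        using 1
      ring
    exact ⟨m1, m2, m3, m4, m5, m6⟩
  simp only [Finset.mem_insert, Finset.mem_singleton, forall_eq_or_imp, forall_eq] at hI
  obtain ⟨-, m2, m3, m4, m5, -⟩ := hI
  have r1 : 3 * a * (x ^ 3 * y) + 2 * b * (x ^ 2 * y ^ 2) + c * (x * y ^ 3) ∈ J := by
    convert J.sub_mem (J.mul_mem_left x h₁) (J.add_mem (J.add_mem (J.mul_mem_left a₁ m2)
      (J.mul_mem_left b₁ m3)) (J.mul_mem_left c₁ m4)) using 1
    ring
  have r2 : a * (x ^ 3 * y) + 2 * b * (x ^ 2 * y ^ 2) + 3 * c * (x * y ^ 3) ∈ J := by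
    convert J.sub_mem (J.mul_mem_left y h₂) (J.add_mem (J.add_mem (J.mul_mem_left a₂ m3)
      (J.mul_mem_left b₂ m4)) (J.mul_mem_left c₂ m5)) using 1
    ring
  refine ⟨![1, x, y, x ^ 2, x * y, y ^ 2, x ^ 2 * y, x * y ^ 2, x ^ 2 * y ^ 2], fun r => ?_⟩
  set v := ![1, x, y, x ^ 2, x * y, y ^ 2, x ^ 2 * y, x * y ^ 2, x ^ 2 * y ^ 2] with hv
  set W := Submodule.span ℂ (Set.range v) ⊔ J.restrictScalars ℂ with hW
  have w : ∀ i, v i ∈ W := fun i => Submodule.mem_sup_left (Submodule.subset_span ⟨i, rfl⟩)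
  have hJW : ∀ z ∈ J, z ∈ W := fun z hz => Submodule.mem_sup_right hz
  have w22 : ∀ s, x ^ 2 * y ^ 2 * s ∈ W := by
    refine h.mul_mem_of_mem (w 8) (fun s => hJW _ ?_) (fun s => hJW _ ?_)
    · convert J.mul_mem_left s m3 using 1; ring
    · convert J.mul_mem_left s m4 using 1; ring
  have w13 : ∀ s, x * y ^ 3 * s ∈ W := by
    intro s
    obtain ⟨t, ht⟩ := (u4.mul (u2.mul hc)).exists_right_inv
    have : x * y ^ 3 * s = x ^ 2 * y ^ 2 * (-(4 * b * t * s)) + (t * s) *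
        (3 * (a * (x ^ 3 * y) + 2 * b * (x ^ 2 * y ^ 2) + 3 * c * (x * y ^ 3)) -
          (3 * a * (x ^ 3 * y) + 2 * b * (x ^ 2 * y ^ 2) + c * (x * y ^ 3))) := by
      linear_combination (-(x * y ^ 3 * s)) * ht
    rw [this]
    exact W.add_mem (w22 _) (hJW _ (J.mul_mem_left _ (J.sub_mem (J.mul_mem_left _ r2) r1)))
  have w31 : ∀ s, x ^ 3 * y * s ∈ W := by
    intro s
    obtain ⟨t, ht⟩ := ha.exists_right_inv
    have : x ^ 3 * y * s = x ^ 2 * y ^ 2 * (-(2 * b * t * s)) + x * y ^ 3 * (-(3 * c * t * s))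
        + (t * s) * (a * (x ^ 3 * y) + 2 * b * (x ^ 2 * y ^ 2) + 3 * c * (x * y ^ 3)) := by
      linear_combination (-(x ^ 3 * y * s)) * ht
    rw [this]
    exact W.add_mem (W.add_mem (w22 _) (w13 _)) (hJW _ (J.mul_mem_left _ r2))
  have w21 : ∀ s, x ^ 2 * y * s ∈ W := by
    refine h.mul_mem_of_mem (w 6) (fun s => ?_) (fun s => ?_)
    · convert w31 s using 1; ring
    · convert w22 s using 1; ring
  have w12 : ∀ s, x * y ^ 2 * s ∈ W := by
    refine h.mul_mem_of_mem (w 7) (fun s => ?_) (fun s => ?_)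
    · convert w22 s using 1; ring
    · convert w13 s using 1; ring
  have w30 : ∀ s, x ^ 3 * s ∈ W := by
    intro s
    obtain ⟨t, ht⟩ := ha.exists_right_inv
    have : x ^ 3 * s = x ^ 2 * y * (-(2 * b * t * s + t * s * (a₂ * x + b₂ * y))) +
        x * y ^ 2 * (-(3 * c * t * s + t * s * c₂ * y))
        + (t * s) * (a * x ^ 3 + 2 * b * (x ^ 2 * y) + 3 * c * (x * y ^ 2) +
        x * y * (a₂ * x ^ 2 + b₂ * (x * y) + c₂ * y ^ 2)) := by
      linear_combination (-(x ^ 3 * s)) * ht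
    rw [this]
    exact W.add_mem (W.add_mem (w21 _) (w12 _)) (hJW _ (J.mul_mem_left _ h₂))
  have w03 : ∀ s, y ^ 3 * s ∈ W := by
    intro s
    obtain ⟨t, ht⟩ := hc.exists_right_inv
    have : y ^ 3 * s = x ^ 2 * y * (-(3 * a * t * s + t * s * (a₁ * x + b₁ * y))) +
        x * y ^ 2 * (-(2 * b * t * s + t * s * c₁ * y))
        + (t * s) * (3 * a * (x ^ 2 * y) + 2 * b * (x * y ^ 2) + c * y ^ 3 +
        x * y * (a₁ * x ^ 2 + b₁ * (x * y) + c₁ * y ^ 2)) := by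
      linear_combination (-(y ^ 3 * s)) * ht
    rw [this]
    exact W.add_mem (W.add_mem (w21 _) (w12 _)) (hJW _ (J.mul_mem_left _ h₁))
  have w20 : ∀ s, x ^ 2 * s ∈ W := by
    refine h.mul_mem_of_mem (w 3) (fun s => ?_) (fun s => ?_)
    · convert w30 s using 1; ring
    · convert w21 s using 1; ring
  have w11 : ∀ s, x * y * s ∈ W := by
    refine h.mul_mem_of_mem (w 4) (fun s => ?_) (fun s => ?_)
    · convert w21 s using 1; ring
    · convert w12 s using 1; ring
  have w02 : ∀ s, y ^ 2 * s ∈ W := by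
    refine h.mul_mem_of_mem (w 5) (fun s => ?_) (fun s => ?_)
    · exact w12 s
    · convert w03 s using 1; ring
  have w10 : ∀ s, x * s ∈ W := by
    refine h.mul_mem_of_mem (w 1) (fun s => ?_) (fun s => ?_)
    · convert w20 s using 1; ring
    · convert w11 s using 1; ring
  have w01 : ∀ s, y * s ∈ W := by
    refine h.mul_mem_of_mem (w 2) (fun s => ?_) (fun s => ?_)
    · exact w11 s
    · convert w02 s using 1; ring
  rw [← one_mul r]
  refine h.mul_mem_of_mem (w 0) (fun s => ?_) (fun s => ?_) r
  · rw [mul_assoc]; exact w10 _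
  · rw [mul_assoc]; exact w01 _

end IsParameterSystem

end LocalAlgebra

/-! ### Germs in ℂ⟦s, t⟧: Jacobians, local parameters and the four singularity types. -/

section PlaneGerms

theorem constantCoeff_pderiv_mul (i : Fin 2) (g h : MvPowerSeries (Fin 2) ℂ) :
    MvPowerSeries.constantCoeff (MvPowerSeries.pderiv ℂ i (g * h)) =
      MvPowerSeries.constantCoeff g * MvPowerSeries.constantCoeff (MvPowerSeries.pderiv ℂ i h) +
      MvPowerSeries.constantCoeff h * MvPowerSeries.constantCoeff (MvPowerSeries.pderiv ℂ i g) := by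
  simp

theorem mem_maximalIdeal_iff_constantCoeff (g : MvPowerSeries (Fin 2) ℂ) :
    g ∈ IsLocalRing.maximalIdeal (MvPowerSeries (Fin 2) ℂ) ↔
      MvPowerSeries.constantCoeff g = 0 := by
  rw [IsLocalRing.mem_maximalIdeal, mem_nonunits_iff, MvPowerSeries.isUnit_iff_constantCoeff,
    isUnit_iff_ne_zero, not_not]

theorem isUnit_of_constantCoeff_ne_zero {g : MvPowerSeries (Fin 2) ℂ}
    (h : MvPowerSeries.constantCoeff g ≠ 0) : IsUnit g :=
  MvPowerSeries.isUnit_iff_constantCoeff.2 h.isUnit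

/-- A germ vanishing at the origin is a combination of the coordinates. -/
theorem exists_eq_X_mul_add_X_mul {g : MvPowerSeries (Fin 2) ℂ}
    (hg : MvPowerSeries.constantCoeff g = 0) :
    ∃ u v, g = MvPowerSeries.X 0 * u + MvPowerSeries.X 1 * v := by
  let g' : MvPowerSeries (Fin 2) ℂ := fun n => if n 0 = 0 then MvPowerSeries.coeff n g else 0
  have hg' : ∀ n, MvPowerSeries.coeff n g' = if n 0 = 0 then MvPowerSeries.coeff n g else 0 :=
    fun n => rfl
  have h0 : MvPowerSeries.X 0 ∣ g - g' := by
    rw [MvPowerSeries.X_dvd_iff]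
    intro n hn
    rw [map_sub, hg', if_pos hn, sub_self]
  have h1 : MvPowerSeries.X 1 ∣ g' := by
    rw [MvPowerSeries.X_dvd_iff]
    intro n hn
    rw [hg']
    split_ifs with h
    · have : n = 0 := by
        ext i; fin_cases i
        · exact h
        · exact hn
      rw [this, MvPowerSeries.coeff_zero_eq_constantCoeff_apply, hg]
    · rfl
  obtain ⟨u, hu⟩ := h0
  obtain ⟨v, hv⟩ := h1
  exact ⟨u, v, by rw [← hu, ← hv]; ring⟩

/-- The Jacobian determinant of two germs at the origin. -/
noncomputable def germJacobian (g h : MvPowerSeries (Fin 2) ℂ) : ℂ :=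
  MvPowerSeries.constantCoeff (MvPowerSeries.pderiv ℂ 0 g) *
      MvPowerSeries.constantCoeff (MvPowerSeries.pderiv ℂ 1 h) -
    MvPowerSeries.constantCoeff (MvPowerSeries.pderiv ℂ 1 g) *
      MvPowerSeries.constantCoeff (MvPowerSeries.pderiv ℂ 0 h)

/-- Both germs vanish at the origin, so their linear parts transform by the constant matrix of the
coefficients and the determinant is multiplicative. -/
theorem germJacobian_combination {g h : MvPowerSeries (Fin 2) ℂ}
    (hg : MvPowerSeries.constantCoeff g = 0) (hh : MvPowerSeries.constantCoeff h = 0)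
    (p q r s : MvPowerSeries (Fin 2) ℂ) :
    germJacobian (p * g + q * h) (r * g + s * h) =
      MvPowerSeries.constantCoeff (p * s - q * r) * germJacobian g h := by
  simp only [germJacobian, map_add, map_sub, constantCoeff_pderiv_mul, map_mul, hg, hh]
  ring

theorem germJacobian_X : germJacobian (MvPowerSeries.X 0) (MvPowerSeries.X 1) = 1 := by
  simp [germJacobian]

theorem germJacobian_ne_zero_of_mem_span {g h : MvPowerSeries (Fin 2) ℂ}
    (hg : MvPowerSeries.constantCoeff g = 0) (hh : MvPowerSeries.constantCoeff h = 0)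
    (h0 : MvPowerSeries.X 0 ∈ Ideal.span {g, h}) (h1 : MvPowerSeries.X 1 ∈ Ideal.span {g, h}) :
    germJacobian g h ≠ 0 := by
  rw [Ideal.mem_span_pair] at h0 h1
  obtain ⟨p, q, h0⟩ := h0
  obtain ⟨r, s, h1⟩ := h1
  have := germJacobian_combination hg hh p q r s
  rw [h0, h1, germJacobian_X] at this
  intro h
  simp [h] at this

/-- Germs with nonzero Jacobian are local parameters; the dual derivations are combinations of
the partial derivatives. -/
theorem exists_isParameterSystem {x y : MvPowerSeries (Fin 2) ℂ}
    (hx : MvPowerSeries.constantCoeff x = 0) (hy : MvPowerSeries.constantCoeff y = 0)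
    (hj : germJacobian x y ≠ 0) :
    ∃ D₁ D₂, IsParameterSystem x y D₁ D₂ ∧
      ∀ (J : Ideal (MvPowerSeries (Fin 2) ℂ)) (F : MvPowerSeries (Fin 2) ℂ),
        (∀ i, MvPowerSeries.pderiv ℂ i F ∈ J) → D₁ F ∈ J ∧ D₂ F ∈ J := by
  have hdet : IsUnit (MvPowerSeries.pderiv ℂ 0 x * MvPowerSeries.pderiv ℂ 1 y -
      MvPowerSeries.pderiv ℂ 1 x * MvPowerSeries.pderiv ℂ 0 y) := by
    apply isUnit_of_constantCoeff_ne_zero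
    simpa [germJacobian] using hj
  obtain ⟨e, he⟩ := hdet.exists_right_inv
  -- Cramer's rule: the dual derivations are the rows of the adjugate Jacobian matrix times the
  -- inverse determinant.
  refine ⟨(e * MvPowerSeries.pderiv ℂ 1 y) • MvPowerSeries.pderiv ℂ 0 -
      (e * MvPowerSeries.pderiv ℂ 0 y) • MvPowerSeries.pderiv ℂ 1,
    (e * MvPowerSeries.pderiv ℂ 0 x) • MvPowerSeries.pderiv ℂ 1 -
      (e * MvPowerSeries.pderiv ℂ 1 x) • MvPowerSeries.pderiv ℂ 0, ⟨?_, ?_, ?_, ?_, ?_, ?_⟩, ?_⟩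
  · intro r
    refine ⟨MvPowerSeries.constantCoeff r, ?_⟩
    rw [mem_maximalIdeal_iff_constantCoeff, map_sub, ← MvPowerSeries.c_eq_algebraMap,
      MvPowerSeries.constantCoeff_C, sub_self]
  · apply le_antisymm
    · obtain ⟨x₀, x₁, rfl⟩ := exists_eq_X_mul_add_X_mul hx
      obtain ⟨y₀, y₁, rfl⟩ := exists_eq_X_mul_add_X_mul hy
      have hd : IsUnit (x₀ * y₁ - x₁ * y₀) := by
        apply isUnit_of_constantCoeff_ne_zero
        intro h
        apply hj
        have := germJacobian_combination (MvPowerSeries.constantCoeff_X (R := ℂ) (0 : Fin 2))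
          (MvPowerSeries.constantCoeff_X (R := ℂ) (1 : Fin 2)) x₀ x₁ y₀ y₁
        rw [h, zero_mul] at this
        rw [← this]; congr 1 <;> ring
      set I := Ideal.span {MvPowerSeries.X 0 * x₀ + MvPowerSeries.X 1 * x₁,
        MvPowerSeries.X 0 * y₀ + MvPowerSeries.X 1 * y₁} with hI
      have mx : MvPowerSeries.X 0 * x₀ + MvPowerSeries.X 1 * x₁ ∈ I :=
        Ideal.subset_span (by simp)
      have my : MvPowerSeries.X 0 * y₀ + MvPowerSeries.X 1 * y₁ ∈ I :=
        Ideal.subset_span (by simp)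
      have m0 : MvPowerSeries.X 0 ∈ I := by
        rw [← Ideal.unit_mul_mem_iff_mem I hd]
        convert I.sub_mem (I.mul_mem_left y₁ mx) (I.mul_mem_left x₁ my) using 1
        ring
      have m1 : MvPowerSeries.X 1 ∈ I := by
        rw [← Ideal.unit_mul_mem_iff_mem I hd]
        convert I.sub_mem (I.mul_mem_left x₀ my) (I.mul_mem_left y₀ mx) using 1
        ring
      intro g hg
      rw [mem_maximalIdeal_iff_constantCoeff] at hg
      obtain ⟨u, v, rfl⟩ := exists_eq_X_mul_add_X_mul hg
      exact I.add_mem (I.mul_mem_right _ m0) (I.mul_mem_right _ m1)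
    · rw [Ideal.span_le]
      rintro z (rfl | rfl)
      · exact (mem_maximalIdeal_iff_constantCoeff _).2 hx
      · exact (mem_maximalIdeal_iff_constantCoeff _).2 hy
  · simp only [Derivation.sub_apply, Derivation.smul_apply, smul_eq_mul]
    linear_combination he
  · simp only [Derivation.sub_apply, Derivation.smul_apply, smul_eq_mul]
    ring
  · simp only [Derivation.sub_apply, Derivation.smul_apply, smul_eq_mul]
    ring
  · simp only [Derivation.sub_apply, Derivation.smul_apply, smul_eq_mul]
    linear_combination he
  · intro J F hF
    constructor
    · exact J.sub_mem (J.mul_mem_left _ (hF 0)) (J.mul_mem_left _ (hF 1))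
    · exact J.sub_mem (J.mul_mem_left _ (hF 1)) (J.mul_mem_left _ (hF 0))

theorem constantCoeff_eq_zero_of_order_eq_one {g : MvPowerSeries (Fin 2) ℂ} (hg : g.order = 1) :
    MvPowerSeries.constantCoeff g = 0 := by
  rw [← MvPowerSeries.one_le_order_iff_constCoeff_eq_zero, hg]

theorem exists_constantCoeff_pderiv_ne_zero {g : MvPowerSeries (Fin 2) ℂ} (hg : g.order = 1) :
    ∃ i, MvPowerSeries.constantCoeff (MvPowerSeries.pderiv ℂ i g) ≠ 0 := by
  obtain ⟨d, hd, hd1⟩ := MvPowerSeries.exists_coeff_ne_zero_and_order (f := g) (by rw [hg]; rfl)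
  rw [hg] at hd1
  have hd1' : Finsupp.degree d = 1 := by exact_mod_cast hd1
  obtain ⟨i, rfl⟩ : ∃ i, d = Finsupp.single i 1 := by
    rw [Finsupp.degree_eq_sum, Fin.sum_univ_two] at hd1'
    rcases Nat.add_eq_one_iff.1 hd1' with h | h
    · exact ⟨1, by ext j; fin_cases j <;> simp [h.1, h.2]⟩
    · exact ⟨0, by ext j; fin_cases j <;> simp [h.1, h.2]⟩
  refine ⟨i, ?_⟩
  rw [← MvPowerSeries.coeff_zero_eq_constantCoeff_apply, MvPowerSeries.coeff_pderiv]
  simpa using hd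

/-- Any n + 1 germs are dependent in a quotient of dimension n. Since `finrank` is 0 for an
infinite-dimensional quotient, the condition n ≠ 0 is what supplies finiteness. -/
theorem exists_linear_combination_mem {I : Ideal (MvPowerSeries (Fin 2) ℂ)} {n : ℕ} (hn : n ≠ 0)
    (h : Module.finrank ℂ (MvPowerSeries (Fin 2) ℂ ⧸ I) = n)
    (v : Fin (n + 1) → MvPowerSeries (Fin 2) ℂ) :
    ∃ c : Fin (n + 1) → ℂ, ∑ i, c i • v i ∈ I ∧ ∃ i, c i ≠ 0 := by
  have : Module.Finite ℂ (MvPowerSeries (Fin 2) ℂ ⧸ I) :=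
    Module.finite_of_finrank_pos (by omega)
  have hli : ¬ LinearIndependent ℂ fun i => Ideal.Quotient.mkₐ ℂ I (v i) := by
    intro hl
    have := hl.fintype_card_le_finrank
    rw [h, Fintype.card_fin] at this
    omega
  rw [Fintype.not_linearIndependent_iff] at hli
  obtain ⟨c, hc, hi⟩ := hli
  refine ⟨c, ?_, hi⟩
  rw [← Ideal.Quotient.eq_zero_iff_mem, ← Ideal.Quotient.mkₐ_eq_mk ℂ, map_sum]
  simpa using hc

theorem constantCoeff_eq_zero_of_mem_span {g h z : MvPowerSeries (Fin 2) ℂ}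
    (hg : MvPowerSeries.constantCoeff g = 0) (hh : MvPowerSeries.constantCoeff h = 0)
    (hz : z ∈ Ideal.span {g, h}) : MvPowerSeries.constantCoeff z = 0 := by
  obtain ⟨p, q, rfl⟩ := Ideal.mem_span_pair.1 hz
  simp [hg, hh]

/-- In a quotient of dimension one, 1 and a coordinate are dependent. The coefficient of 1 vanishes
by evaluation at the origin, so the ideal contains both coordinates and the linear parts are
independent. -/
theorem germJacobian_ne_zero {g h : MvPowerSeries (Fin 2) ℂ}
    (hg : MvPowerSeries.constantCoeff g = 0) (hh : MvPowerSeries.constantCoeff h = 0)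
    (hgh : germIntersection g h = 1) : germJacobian g h ≠ 0 := by
  have key : ∀ i : Fin 2, MvPowerSeries.X i ∈ Ideal.span {g, h} := by
    intro i
    obtain ⟨c, hc, hne⟩ := exists_linear_combination_mem one_ne_zero hgh ![1, MvPowerSeries.X i]
    rw [Fin.sum_univ_two] at hc
    have h0 : c 0 = 0 := by
      simpa using constantCoeff_eq_zero_of_mem_span hg hh hc
    have h1 : c 1 ≠ 0 := by
      obtain ⟨j, hj⟩ := hne
      fin_cases j
      · exact absurd h0 hj
      · exact hj
    simp only [h0, zero_smul, zero_add, MvPowerSeries.smul_eq_C_mul] at hc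
    exact (Ideal.unit_mul_mem_iff_mem _ (isUnit_of_constantCoeff_ne_zero (by simpa using h1))).1 hc
  exact germJacobian_ne_zero_of_mem_span hg hh (key 0) (key 1)

theorem hasColengthLE_of_germJacobian_ne_zero {x y : MvPowerSeries (Fin 2) ℂ}
    (hx : MvPowerSeries.constantCoeff x = 0) (hy : MvPowerSeries.constantCoeff y = 0)
    (hj : germJacobian x y ≠ 0) {J : Ideal (MvPowerSeries (Fin 2) ℂ)}
    (hJ : ∀ i, MvPowerSeries.pderiv ℂ i (x * y) ∈ J) : HasColengthLE J 1 := by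
  obtain ⟨D₁, D₂, hD, hD'⟩ := exists_isParameterSystem hx hy hj
  exact hD.node (hD' _ _ hJ).1 (hD' _ _ hJ).2

theorem HasSmoothBranches.colength_node {F : MvPowerSeries (Fin 2) ℂ}
    (hF : HasSmoothBranches F 2 1) {J : Ideal (MvPowerSeries (Fin 2) ℂ)}
    (hJ : ∀ i, MvPowerSeries.pderiv ℂ i F ∈ J) : HasColengthLE J 1 := by
  obtain ⟨g, rfl, ho, hi⟩ := hF
  have h0 := fun i => constantCoeff_eq_zero_of_order_eq_one (ho i)
  rw [Fin.prod_univ_two] at hJ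
  exact hasColengthLE_of_germJacobian_ne_zero (h0 0) (h0 1)
    (germJacobian_ne_zero (h0 0) (h0 1) (hi 0 1 (by decide))) hJ

/-- The first two branches serve as local parameters. The third is a combination of them whose
coefficients are units, because it is transversal to each. -/
theorem HasSmoothBranches.colength_triplePoint {F : MvPowerSeries (Fin 2) ℂ}
    (hF : HasSmoothBranches F 3 1) {J : Ideal (MvPowerSeries (Fin 2) ℂ)}
    (hJ : ∀ i, MvPowerSeries.pderiv ℂ i F ∈ J) : HasColengthLE J 4 := by
  obtain ⟨g, rfl, ho, hi⟩ := hF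
  have h0 := fun i => constantCoeff_eq_zero_of_order_eq_one (ho i)
  have hj := fun i j hij => germJacobian_ne_zero (h0 i) (h0 j) (hi i j hij)
  rw [Fin.prod_univ_three] at hJ
  obtain ⟨D₁, D₂, hD, hD'⟩ := exists_isParameterSystem (h0 0) (h0 1) (hj 0 1 (by decide))
  obtain ⟨a, b, hab⟩ := Ideal.mem_span_pair.1
    (hD.maximal ▸ (mem_maximalIdeal_iff_constantCoeff _).2 (h0 2))
  have ha : IsUnit a := isUnit_of_constantCoeff_ne_zero fun h => hj 1 2 (by decide) (by
    have := germJacobian_combination (h0 0) (h0 1) 0 1 a b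
    rwa [hab, zero_mul, zero_mul, zero_sub, one_mul, one_mul, zero_add, map_neg, h, neg_zero,
      zero_mul] at this)
  have hb : IsUnit b := isUnit_of_constantCoeff_ne_zero fun h => hj 0 2 (by decide) (by
    have := germJacobian_combination (h0 0) (h0 1) 1 0 a b
    rwa [hab, zero_mul, zero_mul, sub_zero, one_mul, one_mul, add_zero, h, zero_mul] at this)
  rw [← hab] at hJ
  exact hD.triplePoint ha hb (hD' _ _ hJ).1 (hD' _ _ hJ).2

theorem HasSmoothBranches.colength_quadruplePoint {F : MvPowerSeries (Fin 2) ℂ}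
    (hF : HasSmoothBranches F 4 1) {J : Ideal (MvPowerSeries (Fin 2) ℂ)}
    (hJ : ∀ i, MvPowerSeries.pderiv ℂ i F ∈ J) : HasColengthLE J 9 := by
  obtain ⟨g, rfl, ho, hi⟩ := hF
  have h0 := fun i => constantCoeff_eq_zero_of_order_eq_one (ho i)
  have hj := fun i j hij => germJacobian_ne_zero (h0 i) (h0 j) (hi i j hij)
  rw [Fin.prod_univ_four] at hJ
  obtain ⟨D₁, D₂, hD, hD'⟩ := exists_isParameterSystem (h0 0) (h0 1) (hj 0 1 (by decide))
  obtain ⟨a, b, hab⟩ := Ideal.mem_span_pair.1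
    (hD.maximal ▸ (mem_maximalIdeal_iff_constantCoeff _).2 (h0 2))
  obtain ⟨c, d, hcd⟩ := Ideal.mem_span_pair.1
    (hD.maximal ▸ (mem_maximalIdeal_iff_constantCoeff _).2 (h0 3))
  have hfirst : ∀ (j : Fin 4) (p q : MvPowerSeries (Fin 2) ℂ), 1 ≠ j → p * g 0 + q * g 1 = g j →
      IsUnit p := fun j p q h1j hpq => isUnit_of_constantCoeff_ne_zero fun h => hj 1 j h1j (by
    have := germJacobian_combination (h0 0) (h0 1) 0 1 p q
    rwa [hpq, zero_mul, zero_mul, zero_sub, one_mul, one_mul, zero_add, map_neg, h, neg_zero,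
      zero_mul] at this)
  have hsecond : ∀ (j : Fin 4) (p q : MvPowerSeries (Fin 2) ℂ), 0 ≠ j → p * g 0 + q * g 1 = g j →
      IsUnit q := fun j p q h0j hpq => isUnit_of_constantCoeff_ne_zero fun h => hj 0 j h0j (by
    have := germJacobian_combination (h0 0) (h0 1) 1 0 p q
    rwa [hpq, zero_mul, zero_mul, sub_zero, one_mul, one_mul, add_zero, h, zero_mul] at this)
  have hdisc : IsUnit (a * d - b * c) := isUnit_of_constantCoeff_ne_zero fun h =>
    hj 2 3 (by decide) (by
      have := germJacobian_combination (h0 0) (h0 1) a b c d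
      rwa [hab, hcd, h, zero_mul] at this)
  have hF : g 0 * g 1 * g 2 * g 3 = g 0 * g 1 *
      (a * c * g 0 ^ 2 + (a * d + b * c) * (g 0 * g 1) + b * d * g 1 ^ 2) := by
    rw [← hab, ← hcd]; ring
  rw [hF] at hJ
  refine hD.quadruplePoint ((hfirst 2 a b (by decide) hab).mul (hfirst 3 c d (by decide) hcd))
    ((hsecond 2 a b (by decide) hab).mul (hsecond 3 c d (by decide) hcd)) ?_
    (hD' _ _ hJ).1 (hD' _ _ hJ).2
  -- The discriminant of (a x + b y)(c x + d y) is (ad - bc)².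
  convert hdisc.pow 2 using 1
  ring

/-- With the first branch as parameter x and any complementary y, the second branch takes the form a
x + b y². Intersection multiplicity two forces both a and b to be units. -/
theorem HasSmoothBranches.colength_tacnode {F : MvPowerSeries (Fin 2) ℂ}
    (hF : HasSmoothBranches F 2 2) {J : Ideal (MvPowerSeries (Fin 2) ℂ)} (hFJ : F ∈ J)
    (hJ : ∀ i, MvPowerSeries.pderiv ℂ i F ∈ J) : HasColengthLE J 3 := by
  obtain ⟨g, rfl, ho, hi⟩ := hF
  have h0 := fun i => constantCoeff_eq_zero_of_order_eq_one (ho i)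
  rw [Fin.prod_univ_two] at hJ hFJ
  obtain ⟨y, hy, hj⟩ : ∃ y, MvPowerSeries.constantCoeff y = 0 ∧ germJacobian (g 0) y ≠ 0 := by
    obtain ⟨i, hi⟩ := exists_constantCoeff_pderiv_ne_zero (ho 0)
    fin_cases i
    · exact ⟨MvPowerSeries.X 1, by simp, by simpa [germJacobian] using hi⟩
    · exact ⟨MvPowerSeries.X 0, by simp, by
        simpa [germJacobian, MvPowerSeries.pderiv_X] using hi⟩
  obtain ⟨D₁, D₂, hD, hD'⟩ := exists_isParameterSystem (h0 0) hy hj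
  obtain ⟨a', c, hac⟩ := Ideal.mem_span_pair.1
    (hD.maximal ▸ (mem_maximalIdeal_iff_constantCoeff _).2 (h0 1))
  have hfr := hi 0 1 (by decide)
  rw [germIntersection] at hfr
  have mg0 : g 0 ∈ Ideal.span {g 0, g 1} := Ideal.subset_span (by simp)
  have mg1 : g 1 ∈ Ideal.span {g 0, g 1} := Ideal.subset_span (by simp)
  -- Otherwise x and y both lie in the ideal of the two branches, and the intersection multiplicity
  -- is at most one.
  have hc : MvPowerSeries.constantCoeff c = 0 := by
    by_contra hc
    have hyI : y ∈ Ideal.span {g 0, g 1} := by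
      rw [← Ideal.unit_mul_mem_iff_mem _ (isUnit_of_constantCoeff_ne_zero hc)]
      convert Ideal.sub_mem _ mg1 (Ideal.mul_mem_left _ a' mg0) using 1
      rw [← hac]; ring
    have := (hD.node (J := Ideal.span {g 0, g 1}) (by simpa [hD.D₁x, hD.D₁y] using hyI)
      (by simpa [hD.D₂x, hD.D₂y] using mg0)).finite_and_finrank_le.2
    omega
  obtain ⟨p, b, hpb⟩ := Ideal.mem_span_pair.1
    (hD.maximal ▸ (mem_maximalIdeal_iff_constantCoeff _).2 hc)
  obtain ⟨a, ha⟩ : ∃ a, a = a' + p * y := ⟨_, rfl⟩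
  have hg1 : g 1 = a * g 0 + b * y ^ 2 := by
    rw [← hac, ← hpb, ha]; ring
  have hau : IsUnit a := isUnit_of_constantCoeff_ne_zero fun h => by
    obtain ⟨i, hi⟩ := exists_constantCoeff_pderiv_ne_zero (ho 1)
    apply hi
    rw [hg1, map_add, map_add, constantCoeff_pderiv_mul, constantCoeff_pderiv_mul, h, h0 0]
    simp [hy]
  -- If b vanished at the origin, a dependence of 1, y, y² modulo the two branches would reduce to x
  -- ∣ y². Applying the derivation dual to y twice gives 2 on one side and 0 on the other.
  have hbu : IsUnit b := isUnit_of_constantCoeff_ne_zero fun h => by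
    obtain ⟨e, he, hne⟩ := exists_linear_combination_mem two_ne_zero hfr ![1, y, y ^ 2]
    obtain ⟨r, s, hrs⟩ := Ideal.mem_span_pair.1 he
    rw [Fin.sum_univ_three] at hrs
    simp only [Matrix.cons_val_zero, Matrix.cons_val_one, Matrix.cons_val_two, Matrix.head_cons,
      Matrix.tail_cons] at hrs
    have e0 : e 0 = 0 := by
      have := congrArg MvPowerSeries.constantCoeff hrs
      simpa [h0, hy, eq_comm] using this
    rw [hg1, e0, zero_smul, zero_add] at hrs
    have e1 : e 1 = 0 := by
      have := congrArg (fun z => MvPowerSeries.constantCoeff (D₂ z)) hrs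
      simpa [h0, hy, hD.D₂x, hD.D₂y, Derivation.leibniz_pow, eq_comm] using this
    have e2 : e 2 ≠ 0 := by
      obtain ⟨j, hj⟩ := hne
      fin_cases j
      · exact absurd e0 hj
      · exact absurd e1 hj
      · exact hj
    rw [e1, zero_smul, zero_add, MvPowerSeries.smul_eq_C_mul] at hrs
    have hu : IsUnit (MvPowerSeries.C (e 2) - s * b) :=
      isUnit_of_constantCoeff_ne_zero (by simpa [h] using e2)
    obtain ⟨t, ht⟩ := hu.exists_right_inv
    have hy2 : y ^ 2 = (t * (r + s * a)) * g 0 := by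
      linear_combination (-y ^ 2) * ht - t * hrs
    have := congrArg (fun z => MvPowerSeries.constantCoeff (D₂ (D₂ z))) hy2
    have h2 : MvPowerSeries.constantCoeff (2 : MvPowerSeries (Fin 2) ℂ) = 2 := by
      rw [show (2 : MvPowerSeries (Fin 2) ℂ) = 1 + 1 by norm_num, map_add, map_one]; norm_num
    simp [h0, hy, hD.D₂x, hD.D₂y, Derivation.leibniz_pow] at this
    exact two_ne_zero (h2.symm.trans this)
  rw [hg1] at hJ hFJ
  exact hD.tacnode hau hbu hFJ (hD' _ _ hJ).1 (hD' _ _ hJ).2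

end PlaneGerms

/-! ### From the completed local ring at a point back to homogeneous polynomials. -/

section Localization

/-- The chain rule for a derivation and a polynomial substitution. -/
theorem derivation_aeval {σ B : Type*} [Fintype σ] [CommRing B] [Algebra ℂ B]
    (D : Derivation ℂ B B) (g : σ → B) (F : MvPolynomial σ ℂ) :
    D (aeval g F) = ∑ i, aeval g (pderiv i F) * D (g i) := by
  classical
  induction F using MvPolynomial.induction_on with
  | C a => simp
  | add p q hp hq => simp [hp, hq, add_mul, Finset.sum_add_distrib]
  | mul_X p j hp =>
    simp only [map_mul, aeval_X, Derivation.leibniz, hp, smul_eq_mul, map_add, add_mul,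
      Finset.sum_add_distrib, pderiv_X, Finset.mul_sum]
    congr 1
    · rw [Finset.sum_eq_single j]
      · simp
      · intro b _ hb; simp [hb.symm]
      · simp
    · exact Finset.sum_congr rfl fun i _ => by ring

theorem aeval_mul_const_of_isHomogeneous {σ B : Type*} [CommRing B] [Algebra ℂ B]
    {F : MvPolynomial σ ℂ} {n : ℕ} (hF : F.IsHomogeneous n) (g : σ → B) (t : B) :
    aeval (fun i => g i * t) F = aeval g F * t ^ n := by
  rw [aeval_def, aeval_def, eval₂_eq, eval₂_eq, Finset.sum_mul]
  refine Finset.sum_congr rfl fun d hd => ?_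
  have : ∑ i ∈ d.support, d i = n := by
    rw [← hF.degree_eq_sum_deg_support hd]
  simp only [mul_pow, Finset.prod_mul_distrib, Finset.prod_pow_eq_pow_sum, this]
  ring

theorem eval_smul_of_isHomogeneous {σ : Type*} {F : MvPolynomial σ ℂ} {n : ℕ}
    (hF : F.IsHomogeneous n) (c : ℂ) (v : σ → ℂ) : eval (c • v) F = c ^ n * eval v F := by
  have := aeval_mul_const_of_isHomogeneous hF v c
  rw [aeval_eq_eval, aeval_eq_eval] at this
  rw [mul_comm, ← this]
  congr 2; ext i; simp [mul_comm]

/-- Dehomogenization in the affine chart with coordinates `a, b` centred at `v`. -/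
noncomputable def localHom (v a b : Fin 3 → ℂ) :
    MvPolynomial (Fin 3) ℂ →ₐ[ℂ] MvPolynomial (Fin 2) ℂ :=
  aeval fun i : Fin 3 => C (v i) + C (a i) * X 0 + C (b i) * X 1

theorem localHom_apply (v a b : Fin 3 → ℂ) (f : MvPolynomial (Fin 3) ℂ) :
    localHom v a b f = localEquation f v a b := rfl

/-- The germ at `v` of the dehomogenization of a polynomial. -/
noncomputable def germHom (v a b : Fin 3 → ℂ) :
    MvPolynomial (Fin 3) ℂ →ₐ[ℂ] MvPowerSeries (Fin 2) ℂ :=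
  (coeToMvPowerSeries.algHom ℂ).comp (localHom v a b)

theorem germHom_apply (v a b : Fin 3 → ℂ) (f : MvPolynomial (Fin 3) ℂ) :
    germHom v a b f = (localEquation f v a b : MvPowerSeries (Fin 2) ℂ) := by
  simp [germHom, localHom_apply]

theorem pderiv_germHom (v a b : Fin 3 → ℂ) (f : MvPolynomial (Fin 3) ℂ) (i : Fin 2) :
    MvPowerSeries.pderiv ℂ i (germHom v a b f) =
      ∑ j, germHom v a b (pderiv j f) * MvPowerSeries.C (![a, b] i j) := by
  have : germHom v a b = aeval fun j => germHom v a b (X j) := by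
    ext; simp
  conv_lhs => rw [this, derivation_aeval]
  rw [← this]
  refine Finset.sum_congr rfl fun j _ => ?_
  congr 1
  rw [germHom_apply, MvPowerSeries.pderiv_coe]
  fin_cases i <;> simp [localEquation, pderiv_X]

theorem constantCoeff_germHom (v a b : Fin 3 → ℂ) (f : MvPolynomial (Fin 3) ℂ) :
    MvPowerSeries.constantCoeff (germHom v a b f) = eval v f := by
  rw [germHom_apply, ← MvPowerSeries.coeff_zero_eq_constantCoeff_apply, coeff_coe,
    ← constantCoeff_eq]
  have : (constantCoeff.comp (localHom v a b).toRingHom) = eval v := by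
    ext <;> simp [localHom]
  exact congrArg (fun φ => φ f) this

theorem pderiv_germHom_mem {f : MvPolynomial (Fin 3) ℂ} (v a b : Fin 3 → ℂ) (i : Fin 2) :
    MvPowerSeries.pderiv ℂ i (germHom v a b f) ∈ (jacobianIdeal f).map (germHom v a b) := by
  rw [pderiv_germHom]
  exact Ideal.sum_mem _ fun j _ => Ideal.mul_mem_right _ _
    (Ideal.mem_map_of_mem _ (Ideal.subset_span ⟨j, rfl⟩))

/-- Euler's relation. Besides identifying the zeros of J_f with singular points, it supplies the
membership of the germ required at tacnodes. -/
theorem mem_jacobianIdeal {f : MvPolynomial (Fin 3) ℂ} {d : ℕ} (hd : d ≠ 0)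
    (hf : f.IsHomogeneous d) : f ∈ jacobianIdeal f := by
  have h : ∑ i, X i * pderiv i f ∈ jacobianIdeal f :=
    Ideal.sum_mem _ fun j _ => Ideal.mul_mem_left _ _ (Ideal.subset_span ⟨j, rfl⟩)
  rw [hf.sum_X_mul_pderiv] at h
  have := (jacobianIdeal f).mul_mem_left (C (d : ℂ)⁻¹) h
  rwa [nsmul_eq_mul, ← mul_assoc, ← C_eq_coe_nat, ← C_mul,
    inv_mul_cancel₀ (by exact_mod_cast hd), C_1, one_mul] at this

/-- Krull's intersection theorem: a polynomial that lies in an ideal after passing to power series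
lies in it after multiplication by a polynomial with constant coefficient one. -/
theorem exists_mul_mem_of_coe_mem (I : Ideal (MvPolynomial (Fin 2) ℂ))
    (G : MvPolynomial (Fin 2) ℂ)
    (hG : (G : MvPowerSeries (Fin 2) ℂ) ∈ I.map coeToMvPowerSeries.ringHom) :
    ∃ u, constantCoeff u = 1 ∧ u * G ∈ I := by
  -- Truncation modulo the N-th power of the maximal ideal turns the power series membership into a
  -- polynomial one.
  have hsup : ∀ N : ℕ, G ∈ I ⊔ idealOfVars (Fin 2) ℂ ^ N := by
    intro N
    let T : MvPowerSeries (Fin 2) ℂ →+* MvPolynomial (Fin 2) ℂ ⧸ idealOfVars (Fin 2) ℂ ^ N :=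
      MvPowerSeries.truncTotalAlgHom (Fin 2) ℂ N
    have hT : T.comp coeToMvPowerSeries.ringHom =
        Ideal.Quotient.mk (idealOfVars (Fin 2) ℂ ^ N) := by
      refine RingHom.ext fun p => ?_
      have := (MvPowerSeries.truncTotalAlgHom (Fin 2) ℂ N).commutes p
      rwa [MvPowerSeries.algebraMap_apply', Algebra.algebraMap_self, MvPowerSeries.map_id] at this
    have h1 := Ideal.mem_map_of_mem T hG
    rw [Ideal.map_map, hT] at h1
    rw [← Ideal.mem_quotient_iff_mem_sup, ← hT]
    rw [← hT] at h1
    exact h1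
  have hk : Ideal.Quotient.mk I G ∈
      (⨅ N : ℕ, idealOfVars (Fin 2) ℂ ^ N • ⊤ :
        Submodule (MvPolynomial (Fin 2) ℂ) (MvPolynomial (Fin 2) ℂ ⧸ I)) := by
    rw [Submodule.mem_iInf]
    intro N
    obtain ⟨j, hj, g, hg, hjg⟩ := Submodule.mem_sup.1 (hsup N)
    have : Ideal.Quotient.mk I G = g • (1 : MvPolynomial (Fin 2) ℂ ⧸ I) := by
      rw [← hjg, map_add, Ideal.Quotient.eq_zero_iff_mem.2 hj, zero_add]
      exact (mul_one _).symm
    rw [this]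
    exact Submodule.smul_mem_smul hg trivial
  rw [Ideal.mem_iInf_smul_pow_eq_bot_iff] at hk
  obtain ⟨r, hr⟩ := hk
  refine ⟨1 - r, ?_, ?_⟩
  · have : coeff 0 (r : MvPolynomial (Fin 2) ℂ) = 0 := by
      have h := r.2
      exact (mem_pow_idealOfVars_iff' 1 _).1 (by rwa [pow_one]) 0 (by simp)
    rw [map_sub, map_one, constantCoeff_eq, this, sub_zero]
  · rw [← Ideal.Quotient.eq_zero_iff_mem, sub_mul, one_mul, map_sub, sub_eq_zero]
    exact hr.symm

/-- The linear form with coefficients `φ`. -/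
noncomputable def linearForm (φ : (Fin 3 → ℂ) →ₗ[ℂ] ℂ) : MvPolynomial (Fin 3) ℂ :=
  ∑ j, C (φ (Pi.single j 1)) * X j

theorem eval_linearForm (φ : (Fin 3 → ℂ) →ₗ[ℂ] ℂ) (w : Fin 3 → ℂ) :
    eval w (linearForm φ) = φ w := by
  conv_rhs => rw [← (Pi.basisFun ℂ (Fin 3)).sum_repr w]
  simp [linearForm, mul_comm]

/-- If a homogeneous polynomial belongs to the Jacobian ideal in the completed local ring of the
point `v`, then it does so after multiplication by a polynomial without zeros over `v`. -/
theorem exists_mul_mem_of_germHom_mem {f F : MvPolynomial (Fin 3) ℂ} {e n : ℕ}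
    (hf : f.IsHomogeneous (e + 1)) (hF : F.IsHomogeneous n) {v a b : Fin 3 → ℂ}
    (hli : LinearIndependent ℂ ![a, b, v])
    (h : germHom v a b F ∈ (jacobianIdeal f).map (germHom v a b)) :
    ∃ g, (∀ c : ℂ, c ≠ 0 → eval (c • v) g ≠ 0) ∧ g * F ∈ jacobianIdeal f := by
  obtain ⟨u, hu, huF⟩ := exists_mul_mem_of_coe_mem ((jacobianIdeal f).map (localHom v a b))
    (localHom v a b F) (by
      have hcomp : coeToMvPowerSeries.ringHom.comp (localHom v a b).toRingHom =
          (germHom v a b).toRingHom := RingHom.ext fun G => (germHom_apply v a b G).symm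
      rw [germHom_apply] at h
      change _ ∈ ((jacobianIdeal f).map (localHom v a b).toRingHom).map _
      rw [Ideal.map_map, hcomp]
      exact h)
  let B := basisOfLinearIndependentOfCardEqFinrank hli (by simp)
  have hB : ⇑B = ![a, b, v] := coe_basisOfLinearIndependentOfCardEqFinrank _ _
  have hBa : B 0 = a := by rw [hB]; rfl
  have hBb : B 1 = b := by rw [hB]; rfl
  have hBv : B 2 = v := by rw [hB]; rfl
  set L := linearForm (B.coord 2) with hL
  have hX : ∀ j, (X j : MvPolynomial (Fin 3) ℂ) = C (v j) * L + C (a j) * linearForm (B.coord 0)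
      + C (b j) * linearForm (B.coord 1) := by
    intro j
    apply MvPolynomial.funext
    intro w
    have := congrFun (B.sum_repr w) j
    simp only [Fin.sum_univ_three, hBa, hBb, hBv] at this
    simp only [map_add, map_mul, eval_C, eval_X, hL, eval_linearForm, Module.Basis.coord_apply]
    rw [← this]
    simp; ring
  -- Rehomogenization: L is the linear form that is 1 at v and 0 at a, b. Sending the affine
  -- coordinates to the other two dual forms divided by L maps the dehomogenization of a form G of
  -- degree m to G / L^m.
  let A := Localization.Away L
  let t : A := IsLocalization.Away.invSelf L
  have ht : algebraMap _ A L * t = 1 := IsLocalization.Away.mul_invSelf L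
  let η : MvPolynomial (Fin 2) ℂ →ₐ[ℂ] A :=
    aeval ![algebraMap _ A (linearForm (B.coord 0)) * t, algebraMap _ A (linearForm (B.coord 1)) * t]
  have hη : ∀ G, η (localHom v a b G) =
      aeval (fun j => algebraMap (MvPolynomial (Fin 3) ℂ) A (X j) * t) G := by
    intro G
    have : η.comp (localHom v a b) =
        aeval (fun j => algebraMap (MvPolynomial (Fin 3) ℂ) A (X j) * t) := by
      ext j
      simp only [AlgHom.comp_apply, localHom, aeval_X]
      rw [hX j]
      simp only [map_add, map_mul, ← MvPolynomial.algebraMap_eq, AlgHom.commutes,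
        ← IsScalarTower.algebraMap_apply, η, aeval_X]
      simp only [Matrix.cons_val_zero, Matrix.cons_val_one]
      linear_combination (-algebraMap ℂ A (v j)) * ht
    exact congrArg (fun φ => φ G) this
  have hηhom : ∀ (G : MvPolynomial (Fin 3) ℂ) (m : ℕ), G.IsHomogeneous m →
      η (localHom v a b G) = algebraMap _ A G * t ^ m := by
    intro G m hG
    rw [hη, aeval_mul_const_of_isHomogeneous hG]
    congr 1
    have : (aeval fun j => algebraMap (MvPolynomial (Fin 3) ℂ) A (X j)) =
        IsScalarTower.toAlgHom ℂ (MvPolynomial (Fin 3) ℂ) A := by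
      ext; simp
    rw [this]; rfl
  have hmem : algebraMap _ A F * η u ∈ (jacobianIdeal f).map (algebraMap _ A) := by
    have h1 := Ideal.mem_map_of_mem η huF
    rw [Ideal.map_mapₐ, map_mul, hηhom F n hF] at h1
    have h2 : (jacobianIdeal f).map (η.comp (localHom v a b)) ≤
        (jacobianIdeal f).map (algebraMap _ A) := by
      conv_lhs => rw [jacobianIdeal]
      rw [Ideal.map_span, Ideal.span_le]
      rintro _ ⟨_, ⟨i, rfl⟩, rfl⟩
      have := hηhom (pderiv i f) e hf.pderiv
      rw [SetLike.mem_coe, AlgHom.comp_apply, this]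
      exact Ideal.mul_mem_right _ _ (Ideal.mem_map_of_mem _ (Ideal.subset_span ⟨i, rfl⟩))
    have h3 := Ideal.mul_mem_left _ (algebraMap _ A L ^ n) (h2 h1)
    convert h3 using 1
    have : algebraMap _ A L ^ n * t ^ n = 1 := by rw [← mul_pow, ht, one_pow]
    linear_combination (-(algebraMap _ A F * η u)) * this
  obtain ⟨m, H, hH⟩ := IsLocalization.Away.surj L (η u)
  have hmem2 : algebraMap _ A (H * F) ∈ (jacobianIdeal f).map (algebraMap _ A) := by
    rw [map_mul, ← hH]
    convert Ideal.mul_mem_left _ (algebraMap _ A L ^ m) hmem using 1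
    ring
  rw [IsLocalization.algebraMap_mem_map_algebraMap_iff (Submonoid.powers L)] at hmem2
  obtain ⟨_, ⟨k, rfl⟩, hk⟩ := hmem2
  refine ⟨L ^ k * H, fun c hc => ?_, by rw [mul_assoc]; exact hk⟩
  have e0 : ∀ i, eval (c • v) (linearForm (B.coord i)) = if i = 2 then c else 0 := by
    intro i
    rw [eval_linearForm, map_smul, ← hBv, Module.Basis.coord_apply, B.repr_self,
      Finsupp.single_apply, smul_eq_mul]
    by_cases h : i = 2
    · subst h; simp
    · rw [if_neg (Ne.symm h), if_neg h, mul_zero]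
  have eL : eval (c • v) L = c := by rw [hL, e0, if_pos rfl]
  -- Evaluation at c v extends to the localization because L takes the value c there. It sends both
  -- affine coordinates to 0, hence the image of u to u(0) = 1, so the cleared numerator does not
  -- vanish.
  let ψ : A →+* ℂ := IsLocalization.Away.lift L (g := eval (c • v)) (by rw [eL]; exact hc.isUnit)
  have hψ : ∀ G, ψ (algebraMap _ A G) = eval (c • v) G := IsLocalization.Away.lift_eq L _
  have hψη : ψ (η u) = 1 := by
    have : ψ.comp η.toRingHom = constantCoeff := by
      apply MvPolynomial.ringHom_ext
      · intro z
        have : η (C z) = algebraMap (MvPolynomial (Fin 3) ℂ) A (C z) := by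
          rw [algHom_C, ← MvPolynomial.algebraMap_eq, ← IsScalarTower.algebraMap_apply]
        change ψ (η (C z)) = _
        rw [this, hψ, eval_C, constantCoeff_C]
      · intro i
        fin_cases i <;> simp [η, hψ, e0]
    rw [← hu, ← this]; rfl
  have := congrArg ψ hH
  rw [map_mul, map_pow, hψ, hψ, hψη, eL, one_mul] at this
  rw [map_mul, map_pow, eL, ← this]
  exact mul_ne_zero (pow_ne_zero _ hc) (pow_ne_zero _ hc)

end Localization

/-! ### Dimension count in degree 3m + 3 and the lower bound for free curves. -/

section HilbertFunction

theorem finrank_homogeneousSubmodule (n : ℕ) :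
    Module.finrank ℂ (homogeneousSubmodule (Fin 3) ℂ n) = (n + 2).choose 2 := by
  rw [homogeneousSubmodule_eq_finsupp_supported]
  change Module.finrank ℂ (restrictSupport ℂ {d : Fin 3 →₀ ℕ | d.degree = n}) = _
  rw [Module.finrank_eq_nat_card_basis (basisRestrictSupport ℂ {d : Fin 3 →₀ ℕ | d.degree = n})]
  have : {d : Fin 3 →₀ ℕ | d.degree = n} = ((Finset.univ : Finset (Fin 3)).finsuppAntidiag n : Set _) := by
    ext d
    simp [Finsupp.degree_eq_sum]
  rw [this, Nat.card_coe_set_eq, Set.ncard_coe_finset, Finset.card_finsuppAntidiag_nat_eq_choose,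
    Finset.card_univ, Fintype.card_fin, show 3 + n - 1 = n + 2 by omega]
  exact Nat.choose_symm_of_eq_add rfl

instance finite_homogeneousSubmodule (n : ℕ) :
    Module.Finite ℂ (homogeneousSubmodule (Fin 3) ℂ n) :=
  Module.Finite.iff_fg.2 (homogeneousSubmodule_fg _ _ n)

theorem homogeneousComponent_mul_of_isHomogeneous {g h : MvPolynomial (Fin 3) ℂ} {e : ℕ}
    (hh : h.IsHomogeneous e) (m : ℕ) :
    homogeneousComponent (m + e) (g * h) = homogeneousComponent m g * h := by
  conv_lhs => rw [← sum_homogeneousComponent g]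
  rw [Finset.sum_mul, map_sum, Finset.sum_eq_single m]
  · rw [homogeneousComponent_of_mem ((homogeneousComponent_isHomogeneous m g).mul hh), if_pos rfl]
  · intro i _ hi
    rw [homogeneousComponent_of_mem ((homogeneousComponent_isHomogeneous i g).mul hh), if_neg]
    omega
  · intro hm
    rw [homogeneousComponent_eq_zero m g (by simpa using hm)]
    simp

/-- The degree `m + e` part of an ideal generated by three forms of degree `e` has dimension at
most three times that of the space of forms of degree `m`. -/
theorem finrank_comap_jacobianIdeal_le {f : MvPolynomial (Fin 3) ℂ} {e : ℕ}
    (hf : f.IsHomogeneous (e + 1)) (m : ℕ) :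
    Module.finrank ℂ (((jacobianIdeal f).restrictScalars ℂ).comap
      (homogeneousSubmodule (Fin 3) ℂ (m + e)).subtype) ≤ 3 * (m + 2).choose 2 := by
  let Ψ : (Fin 3 → homogeneousSubmodule (Fin 3) ℂ m) →ₗ[ℂ] homogeneousSubmodule (Fin 3) ℂ (m + e) :=
    { toFun := fun g => ⟨∑ i, (g i : MvPolynomial (Fin 3) ℂ) * pderiv i f,
        IsHomogeneous.sum _ _ _ fun i _ => (g i).2.mul hf.pderiv⟩
      map_add' := fun g h => Subtype.ext (by simp [add_mul, Finset.sum_add_distrib])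
      map_smul' := fun c g => Subtype.ext (by simp [Finset.smul_sum]) }
  have hle : ((jacobianIdeal f).restrictScalars ℂ).comap
      (homogeneousSubmodule (Fin 3) ℂ (m + e)).subtype ≤ LinearMap.range Ψ := by
    rintro ⟨F, hF⟩ hFJ
    have hFJ' : F ∈ Ideal.span (Set.range fun i : Fin 3 => pderiv i f) := hFJ
    obtain ⟨g, hg⟩ := Ideal.mem_span_range_iff_exists_fun.1 hFJ'
    -- In a representation of a form of degree m + e, only the degree m parts of the coefficients
    -- contribute.
    refine ⟨fun i => ⟨homogeneousComponent m (g i), homogeneousComponent_isHomogeneous _ _⟩,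
      Subtype.ext ?_⟩
    have := congrArg (homogeneousComponent (m + e)) hg
    rw [map_sum, homogeneousComponent_of_mem hF, if_pos rfl] at this
    exact (Finset.sum_congr rfl fun i _ =>
      (homogeneousComponent_mul_of_isHomogeneous hf.pderiv m).symm).trans this
  calc _ ≤ Module.finrank ℂ (LinearMap.range Ψ) := Submodule.finrank_mono hle
    _ ≤ Module.finrank ℂ (Fin 3 → homogeneousSubmodule (Fin 3) ℂ m) := LinearMap.finrank_range_le _
    _ = 3 * (m + 2).choose 2 := by
      rw [Module.finrank_pi_fintype]; simp [finrank_homogeneousSubmodule]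

/-- By the Nullstellensatz, a polynomial lying in the Jacobian ideal locally at each singular point
lies in its saturation. -/
theorem mem_idealSaturation_of_forall {f F : MvPolynomial (Fin 3) ℂ} {d : ℕ} (hd : d ≠ 0)
    (hf : f.IsHomogeneous d)
    (h : ∀ w, IsSingularPoint f w → ∃ g, eval w g ≠ 0 ∧ g * F ∈ jacobianIdeal f) :
    F ∈ idealSaturation (jacobianIdeal f) := by
  set I : Ideal (MvPolynomial (Fin 3) ℂ) := (jacobianIdeal f).colon {F} with hI
  have hmem : ∀ g, g ∈ I ↔ g * F ∈ jacobianIdeal f := fun g => Submodule.mem_colon_singleton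
  -- The ideal (J_f : F) contains J_f, so a nonzero common zero would be a singular point; there the
  -- local hypothesis provides an element of (J_f : F) that does not vanish.
  have hzero : ∀ w ∈ zeroLocus ℂ I, w = 0 := by
    intro w hw
    by_contra hne
    rw [mem_zeroLocus_iff] at hw
    simp only [aeval_eq_eval] at hw
    have hJ : ∀ g ∈ jacobianIdeal f, eval w g = 0 := fun g hg =>
      hw g ((hmem g).2 (Ideal.mul_mem_right _ _ hg))
    obtain ⟨g, hg0, hg⟩ := h w ⟨hne, hJ _ (mem_jacobianIdeal hd hf),
      fun i => hJ _ (Ideal.subset_span ⟨i, rfl⟩)⟩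
    exact hg0 (hw g ((hmem g).2 hg))
  have hrad : irrelevantIdeal ≤ I.radical := by
    rw [← vanishingIdeal_zeroLocus_eq_radical (K := ℂ), irrelevantIdeal, Ideal.span_le]
    rintro _ ⟨i, rfl⟩
    rw [SetLike.mem_coe, mem_vanishingIdeal_iff]
    intro w hw
    simp [hzero w hw]
  obtain ⟨n, hn⟩ := Ideal.exists_pow_le_of_le_radical_of_fg hrad
    (Submodule.fg_span (Set.finite_range _))
  refine le_iSup (fun n : ℕ => (jacobianIdeal f).colon
    ((irrelevantIdeal ^ n : Ideal (MvPolynomial (Fin 3) ℂ)) : Set (MvPolynomial (Fin 3) ℂ))) n ?_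
  rw [Submodule.mem_colon]
  intro g hg
  rw [smul_eq_mul, mul_comm]
  exact (hmem g).1 (hn hg)

theorem IsFreeCurve.idealSaturation_le {f : MvPolynomial (Fin 3) ℂ} (hf : IsFreeCurve f) :
    idealSaturation (jacobianIdeal f) ≤ jacobianIdeal f := by
  intro F hF
  have : (⟨F, hF⟩ : idealSaturation (jacobianIdeal f)) ∈
      (jacobianIdeal f).submoduleOf (idealSaturation (jacobianIdeal f)) :=
    (Submodule.Quotient.mk_eq_zero _).1 (@Subsingleton.elim _ hf _ _)
  exact this

/-- For a free curve of degree `2m + 4` the local colengths of the Jacobian ideal add up to more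
than `3(m + 2)(m + 1)`. -/
theorem lt_sum_colength_of_isFreeCurve {f : MvPolynomial (Fin 3) ℂ} {m : ℕ}
    (hf : f.IsHomogeneous (2 * m + 4)) (hfree : IsFreeCurve f) {ι : Type*} [Fintype ι]
    (v a b : ι → Fin 3 → ℂ) (hli : ∀ i, LinearIndependent ℂ ![a i, b i, v i])
    (hv : ∀ w, IsSingularPoint f w → ∃ i, ∃ c : ℂ, c ≠ 0 ∧ w = c • v i) (τ : ι → ℕ)
    (hτ : ∀ i, HasColengthLE ((jacobianIdeal f).map (germHom (v i) (a i) (b i))) (τ i)) :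
    3 * (m + 2) * (m + 1) < ∑ i, τ i := by
  let Q : ι → Type := fun i =>
    MvPowerSeries (Fin 2) ℂ ⧸ (jacobianIdeal f).map (germHom (v i) (a i) (b i))
  have hfin : ∀ i, Module.Finite ℂ (Q i) := fun i => (hτ i).finite_and_finrank_le.1
  let Φ : homogeneousSubmodule (Fin 3) ℂ (m + (2 * m + 3)) →ₗ[ℂ] (∀ i, Q i) :=
    LinearMap.pi fun i => ((Ideal.Quotient.mkₐ ℂ _).comp
      (germHom (v i) (a i) (b i))).toLinearMap ∘ₗ Submodule.subtype _
  have hker : LinearMap.ker Φ ≤ ((jacobianIdeal f).restrictScalars ℂ).comap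
      (homogeneousSubmodule (Fin 3) ℂ (m + (2 * m + 3))).subtype := by
    rintro ⟨F, hF⟩ hΦ
    change F ∈ jacobianIdeal f
    apply hfree.idealSaturation_le
    refine mem_idealSaturation_of_forall (by omega) hf fun w hw => ?_
    obtain ⟨i, c, hc, rfl⟩ := hv w hw
    have hi : germHom (v i) (a i) (b i) F ∈ (jacobianIdeal f).map (germHom (v i) (a i) (b i)) := by
      rw [← Ideal.Quotient.eq_zero_iff_mem]
      exact congrFun (LinearMap.mem_ker.1 hΦ) i
    obtain ⟨g, hg, hgF⟩ := exists_mul_mem_of_germHom_mem (e := 2 * m + 3) hf hF (hli i) hi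
    exact ⟨g, hg c hc, hgF⟩
  have h1 := Φ.finrank_range_add_finrank_ker
  have h2 := (Submodule.finrank_mono hker).trans
    (finrank_comap_jacobianIdeal_le (e := 2 * m + 3) hf m)
  have h3 : Module.finrank ℂ (LinearMap.range Φ) ≤ ∑ i, τ i := by
    refine (Submodule.finrank_le _).trans ?_
    rw [Module.finrank_pi_fintype]
    exact Finset.sum_le_sum fun i _ => (hτ i).finite_and_finrank_le.2
  rw [finrank_homogeneousSubmodule] at h1
  have h6 : (m + 2).choose 2 * 2 = (m + 2) * (m + 1) := by
    rw [← Nat.add_one_mul_choose_eq (m + 1) 1]; simp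
  have h7 : (m + (2 * m + 3) + 2).choose 2 * 2 = (3 * m + 5) * (3 * m + 4) := by
    rw [show m + (2 * m + 3) + 2 = 3 * m + 4 + 1 by ring, ← Nat.add_one_mul_choose_eq (3 * m + 4) 1]
    simp
  -- The difference C(3m+5, 2) - 3 C(m+2, 2) equals 3(m+2)(m+1) + 1, whence the strict inequality.
  nlinarith

end HilbertFunction

/-! ### Smooth conics: normal form, parametrization and Bézout's theorem. -/

section Conics

theorem pderiv_pderiv_comm (i j : Fin 3) (q : MvPolynomial (Fin 3) ℂ) :
    pderiv i (pderiv j q) = pderiv j (pderiv i q) := by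
  ext d
  simp only [coeff_pderiv, Finsupp.add_apply]
  rcases eq_or_ne i j with rfl | h
  · rfl
  · rw [Finsupp.single_eq_of_ne h, Finsupp.single_eq_of_ne h.symm, add_right_comm]
    simp; ring

/-- The polar form of a ternary quadratic form. -/
theorem exists_polarForm {q : MvPolynomial (Fin 3) ℂ} (hq : q.IsHomogeneous 2) :
    ∃ β : LinearMap.BilinForm ℂ (Fin 3 → ℂ), (∀ x y, β x y = β y x) ∧ (∀ x, eval x q = β x x) ∧
      ∀ x y, ∑ i, eval x (pderiv i q) * y i = 2 * β x y := by
  have h1 : ∀ i, (pderiv i q).IsHomogeneous 1 := fun i => hq.pderiv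
  have h0 : ∀ i j, ∃ c, pderiv j (pderiv i q) = C c := fun i j =>
    ⟨_, totalDegree_eq_zero_iff_eq_C.1 ((totalDegree_zero_iff_isHomogeneous _).2 (h1 i).pderiv)⟩
  choose h hh using h0
  have hsymm : ∀ i j, h i j = h j i := fun i j => by
    apply C_injective (Fin 3) ℂ
    rw [← hh, ← hh, pderiv_pderiv_comm]
  have hd : ∀ x i, eval x (pderiv i q) = ∑ j, h i j * x j := by
    intro x i
    have := congrArg (eval x) (h1 i).sum_X_mul_pderiv
    simp only [map_sum, map_mul, eval_X, hh, eval_C, one_smul] at this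
    rw [← this]
    exact Finset.sum_congr rfl fun j _ => mul_comm _ _
  have hq2 : ∀ x, 2 * eval x q = ∑ i, x i * ∑ j, h i j * x j := by
    intro x
    have := congrArg (eval x) hq.sum_X_mul_pderiv
    simp only [map_sum, map_mul, eval_X, hd, nsmul_eq_mul, Nat.cast_ofNat] at this
    rw [this, map_ofNat]
  refine ⟨Matrix.toBilin' (Matrix.of fun i j => h i j / 2), fun x y => ?_, fun x => ?_,
    fun x y => ?_⟩
  · simp only [Matrix.toBilin'_apply, Fin.sum_univ_three, Matrix.of_apply, hsymm 1 0, hsymm 2 0,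
      hsymm 2 1]
    ring
  · apply mul_left_cancel₀ (two_ne_zero (α := ℂ))
    rw [hq2]
    simp only [Matrix.toBilin'_apply, Fin.sum_univ_three, Matrix.of_apply]
    ring
  · simp only [hd, Matrix.toBilin'_apply, Fin.sum_univ_three, Matrix.of_apply, hsymm 1 0,
      hsymm 2 0, hsymm 2 1]
    ring

/-- A smooth conic is `αγ = t²` in coordinates centred at any of its points. -/
theorem exists_normal_form {q : MvPolynomial (Fin 3) ℂ} (hq : IsSmoothConic q)
    {β : LinearMap.BilinForm ℂ (Fin 3 → ℂ)} (hsymm : ∀ x y, β x y = β y x)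
    (hβ : ∀ x, eval x q = β x x) (hd : ∀ x y, ∑ i, eval x (pderiv i q) * y i = 2 * β x y)
    {p : Fin 3 → ℂ} (hp0 : p ≠ 0) (hp : eval p q = 0) :
    ∃ u w, LinearIndependent ℂ ![p, u, w] ∧ β p p = 0 ∧ β p u = 0 ∧ β p w = 1 / 2 ∧ β u u = -1 ∧
      β u w = 0 ∧ β w w = 0 := by
  have hnd : ∀ x, x ≠ 0 → eval x q = 0 → ∃ y, β x y ≠ 0 := by
    intro x hx hxq
    by_contra! hc
    refine hq.2 x ⟨hx, hxq, fun i => ?_⟩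
    have := hd x (Pi.single i 1)
    rw [hc, mul_zero] at this
    simpa [Pi.single_apply] using this
  have hpp : β p p = 0 := by rw [← hβ, hp]
  obtain ⟨w₀, hw₀⟩ := hnd p hp0 hp
  obtain ⟨w₁, hw₁⟩ : ∃ w₁, β p w₁ = 1 / 2 :=
    ⟨(1 / 2 * (β p w₀)⁻¹) • w₀, by rw [map_smul, smul_eq_mul]; field_simp⟩
  -- Subtracting a multiple of the isotropic vector p makes w isotropic without changing its pairing
  -- with p.
  obtain ⟨w, hpw, hww⟩ : ∃ w, β p w = 1 / 2 ∧ β w w = 0 := by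
    refine ⟨w₁ - β w₁ w₁ • p, ?_, ?_⟩
    · simp [hpp, hw₁]
    · simp only [map_sub, map_smul, LinearMap.sub_apply, LinearMap.smul_apply, smul_eq_mul, hpp,
        hw₁, hsymm w₁ p]
      ring
  obtain ⟨u₀, hu₀, hpu₀⟩ : ∃ u₀, u₀ ∉ Submodule.span ℂ {p} ∧ β p u₀ = 0 := by
    by_contra! hc
    have hle : LinearMap.ker (β p) ≤ Submodule.span ℂ {p} := fun x hx => by
      by_contra hx'
      exact hc x hx' hx
    have h1 := Submodule.finrank_mono hle
    have h2 := (β p).finrank_range_add_finrank_ker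
    have h3 : Module.finrank ℂ (LinearMap.range (β p)) ≤ 1 :=
      (Submodule.finrank_le _).trans (Module.finrank_self ℂ).le
    rw [finrank_span_singleton hp0] at h1
    simp at h2
    omega
  obtain ⟨u₁, hu₁, hpu₁, huw₁⟩ : ∃ u, u ≠ 0 ∧ β p u = 0 ∧ β u w = 0 := by
    refine ⟨u₀ - (2 * β u₀ w) • p, fun h => hu₀ ?_, ?_, ?_⟩
    · rw [sub_eq_zero.1 h]
      exact Submodule.smul_mem _ _ (Submodule.mem_span_singleton_self p)
    · simp [hpp, hpu₀]
    · simp [hpw]; ring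
  have hli : ∀ u, u ≠ 0 → β p u = 0 → β u w = 0 → LinearIndependent ℂ ![p, u, w] := by
    intro u hu hpu huw
    rw [Fintype.linearIndependent_iff]
    intro g hg
    rw [Fin.sum_univ_three] at hg
    simp only [Matrix.cons_val_zero, Matrix.cons_val_one, Matrix.cons_val_two, Matrix.head_cons,
      Matrix.tail_cons] at hg
    have g0 : g 0 = 0 := by
      have := congrArg (fun z => β z w) hg
      simpa [hpw, huw, hww] using this
    have g2 : g 2 = 0 := by
      have := congrArg (fun z => β p z) hg
      simpa [hpp, hpu, hpw] using this
    rw [g0, g2] at hg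
    have g1 : g 1 = 0 := by simpa [hu] using hg
    intro i; fin_cases i
    · exact g0
    · exact g1
    · exact g2
  -- Otherwise u₁ would be orthogonal to the whole basis, hence a singular point of the conic.
  have hκ : β u₁ u₁ ≠ 0 := by
    intro hκ
    obtain ⟨y, hy⟩ := hnd u₁ hu₁ (by rw [hβ, hκ])
    have hspan := (hli u₁ hu₁ hpu₁ huw₁).span_eq_top_of_card_eq_finrank (by simp)
    apply hy
    have hy' : y ∈ Submodule.span ℂ (Set.range ![p, u₁, w]) := hspan ▸ trivial
    have hle : Submodule.span ℂ (Set.range ![p, u₁, w]) ≤ LinearMap.ker (β u₁) := by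
      rw [Submodule.span_le]
      rintro _ ⟨i, rfl⟩
      fin_cases i
      · exact (hsymm _ _).trans hpu₁
      · exact hκ
      · exact huw₁
    exact hle hy'
  obtain ⟨s, hs⟩ := IsAlgClosed.exists_pow_nat_eq (-(β u₁ u₁)⁻¹) (n := 2) two_pos
  have hs0 : s ≠ 0 := by
    rintro rfl
    apply hκ
    simpa using hs.symm
  refine ⟨s • u₁, w, hli _ (smul_ne_zero hs0 hu₁) ?_ ?_, hpp, ?_, hpw, ?_, ?_, hww⟩
  · simp [hpu₁]
  · simp [huw₁]
  · simp [hpu₁]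
  · simp only [map_smul, LinearMap.smul_apply, smul_eq_mul]
    rw [← mul_assoc, ← pow_two, hs]
    field_simp
  · simp [huw₁]

theorem exists_eq_combination {p u w : Fin 3 → ℂ} (h : LinearIndependent ℂ ![p, u, w])
    (x : Fin 3 → ℂ) : ∃ α t γ : ℂ, x = α • p + t • u + γ • w := by
  have hspan := h.span_eq_top_of_card_eq_finrank (by simp)
  have hx : x ∈ Submodule.span ℂ (Set.range ![p, u, w]) := hspan ▸ trivial
  obtain ⟨c, hc⟩ := (Submodule.mem_span_range_iff_exists_fun ℂ).1 hx
  rw [Fin.sum_univ_three] at hc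
  exact ⟨c 0, c 1, c 2, hc.symm⟩

/-- The quadratic formula on the line through the first two coordinate points. -/
theorem exists_zero_of_isHomogeneous_two {q : MvPolynomial (Fin 3) ℂ} (hq : q.IsHomogeneous 2) :
    ∃ p : Fin 3 → ℂ, p ≠ 0 ∧ eval p q = 0 := by
  obtain ⟨β, hsymm, hβ, -⟩ := exists_polarForm hq
  set e : Fin 3 → Fin 3 → ℂ := fun i => Pi.single i 1
  by_cases h : β (e 0) (e 0) = 0
  · exact ⟨e 0, by simp [e], by rw [hβ, h]⟩
  · obtain ⟨s, hs⟩ := IsAlgClosed.exists_pow_nat_eq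
      (β (e 0) (e 1) ^ 2 - β (e 0) (e 0) * β (e 1) (e 1)) (n := 2) two_pos
    refine ⟨(s - β (e 0) (e 1)) • e 0 + β (e 0) (e 0) • e 1, fun h0 => h ?_, ?_⟩
    · simpa [e] using congrFun h0 1
    · rw [hβ]
      simp only [map_add, map_smul, LinearMap.add_apply, LinearMap.smul_apply, smul_eq_mul,
        hsymm (e 1) (e 0)]
      linear_combination β (e 0) (e 0) * hs

/-- Two smooth conics with the same points have the same equation up to a constant. -/
theorem exists_mem_conic_not_mem {q q' : MvPolynomial (Fin 3) ℂ} (hq : IsSmoothConic q)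
    (hq' : IsSmoothConic q') (hne : ¬ Associated q q') :
    ∃ p : Fin 3 → ℂ, p ≠ 0 ∧ eval p q = 0 ∧ eval p q' ≠ 0 := by
  by_contra! hc
  obtain ⟨p, hp0, hp⟩ := exists_zero_of_isHomogeneous_two hq.1
  obtain ⟨β, hsymm, hβ, hd⟩ := exists_polarForm hq.1
  obtain ⟨β', hsymm', hβ', -⟩ := exists_polarForm hq'.1
  obtain ⟨u, w, hli, hpp, hpu, hpw, huu, huw, hww⟩ := exists_normal_form hq hsymm hβ hd hp0 hp
  have hval : ∀ α t γ : ℂ, eval (α • p + t • u + γ • w) q = α * γ - t ^ 2 := by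
    intro α t γ
    rw [hβ]
    simp only [map_add, map_smul, LinearMap.add_apply, LinearMap.smul_apply, smul_eq_mul, hpp, hpu,
      hpw, huu, huw, hww, hsymm u p, hsymm w p, hsymm w u]
    ring
  have hval' : ∀ α t γ : ℂ, eval (α • p + t • u + γ • w) q' = α ^ 2 * β' p p + 2 * α * t * β' p u +
      2 * α * γ * β' p w + t ^ 2 * β' u u + 2 * t * γ * β' u w + γ ^ 2 * β' w w := by
    intro α t γ
    rw [hβ']
    simp only [map_add, map_smul, LinearMap.add_apply, LinearMap.smul_apply, smul_eq_mul,
      hsymm' u p, hsymm' w p, hsymm' w u]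
    ring
  -- The points t²p + tu + w lie on the first conic, so the second form vanishes identically along
  -- this parametrization. Its five coefficients are then recovered from the values at 0, ±1, ±2.
  have hcurve : ∀ t : ℂ, t ^ 4 * β' p p + 2 * t ^ 3 * β' p u + t ^ 2 * (2 * β' p w + β' u u) +
      2 * t * β' u w + β' w w = 0 := by
    intro t
    have hne : (t ^ 2) • p + t • u + (1 : ℂ) • w ≠ 0 := by
      intro h0
      have := congrArg (fun z => β p z) h0
      simp [hpp, hpu, hpw] at this
    have h := hc _ hne (by rw [hval]; ring)
    rw [hval'] at h
    linear_combination h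
  have c0 := hcurve 0
  have c1 := hcurve 1
  have c2 := hcurve (-1)
  have c3 := hcurve 2
  have c4 := hcurve (-2)
  norm_num at c0 c1 c2 c3 c4
  have e00 : β' p p = 0 := by linear_combination (c3 + c4 - 4 * c1 - 4 * c2 + 6 * c0) / 24
  have e01 : β' p u = 0 := by linear_combination (c3 - c4 - 2 * c1 + 2 * c2) / 24
  have e12 : β' u w = 0 := by linear_combination (8 * c1 - 8 * c2 - c3 + c4) / 24
  have e11 : β' u u = -2 * β' p w := by linear_combination (c1 + c2) / 2 - c0 - e00
  have heq : q' = C (2 * β' p w) * q := by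
    apply MvPolynomial.funext
    intro x
    obtain ⟨α, t, γ, rfl⟩ := exists_eq_combination hli x
    rw [map_mul, eval_C, hval, hval', e00, e01, e12, e11, c0]
    ring
  by_cases h0 : 2 * β' p w = 0
  · rw [h0, C_0, zero_mul] at heq
    exact hq'.2 p ⟨hp0, by rw [heq]; simp, fun i => by rw [heq]; simp⟩
  · apply hne
    rw [heq]
    exact (associated_unit_mul_right _ _ ((IsUnit.mk0 _ h0).map C))

open Classical in
/-- The order of contact of two smooth conics at a point, truncated at two. -/
noncomputable def meetOrder (q q' : MvPolynomial (Fin 3) ℂ) (v : Fin 3 → ℂ) : ℕ :=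
  if eval v q = 0 ∧ eval v q' = 0 then
    if ∃ c, ∀ i, eval v (pderiv i q') = c * eval v (pderiv i q) then 2 else 1
  else 0

/-- Bézout's theorem for two smooth conics. -/
theorem sum_meetOrder_le {q q' : MvPolynomial (Fin 3) ℂ} (hq : IsSmoothConic q)
    (hq' : IsSmoothConic q') (hne : ¬ Associated q q') {ι : Type*} (s : Finset ι)
    (v : ι → Fin 3 → ℂ) (hv : ∀ i, v i ≠ 0) (hinj : ∀ i j, ∀ c : ℂ, v i = c • v j → i = j) :
    ∑ i ∈ s, meetOrder q q' (v i) ≤ 4 := by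
  classical
  obtain ⟨p, hp0, hp, hp'⟩ := exists_mem_conic_not_mem hq hq' hne
  obtain ⟨β, hsymm, hβ, hd⟩ := exists_polarForm hq.1
  obtain ⟨β', hsymm', hβ', hd'⟩ := exists_polarForm hq'.1
  obtain ⟨u, w, hli, hpp, hpu, hpw, huu, huw, hww⟩ := exists_normal_form hq hsymm hβ hd hp0 hp
  -- G is the second form along the parametrization t²p + tu + w of the first conic. The point p, at
  -- t = ∞, was chosen off the second conic, so the coefficient of t⁴ is nonzero and no common point
  -- is lost at infinity.
  set G : Polynomial ℂ := Polynomial.C (β' p p) * Polynomial.X ^ 4 +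
    Polynomial.C (2 * β' p u) * Polynomial.X ^ 3 +
    Polynomial.C (2 * β' p w + β' u u) * Polynomial.X ^ 2 +
    Polynomial.C (2 * β' u w) * Polynomial.X + Polynomial.C (β' w w) with hG
  have hGdeg : G.natDegree ≤ 4 := by rw [hG]; compute_degree
  have hGne : G ≠ 0 := by
    intro h0
    apply hp'
    rw [hβ']
    have : G.coeff 4 = β' p p := by rw [hG]; simp only [Polynomial.coeff_add,
      Polynomial.coeff_C_mul, Polynomial.coeff_X_pow, Polynomial.coeff_X, Polynomial.coeff_C]; norm_num
    rw [← this, h0, Polynomial.coeff_zero]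
  have hpoint : ∀ i, meetOrder q q' (v i) ≠ 0 → ∃ t γ : ℂ, γ ≠ 0 ∧
      v i = γ • (t ^ 2 • p + t • u + w) := by
    intro i hi
    have hi' : eval (v i) q = 0 ∧ eval (v i) q' = 0 := by
      by_contra hcon
      exact hi (if_neg hcon)
    obtain ⟨α, t, γ, hx⟩ := exists_eq_combination hli (v i)
    have h1 : α * γ = t ^ 2 := by
      have := hi'.1
      rw [hx, hβ] at this
      simp only [map_add, map_smul, LinearMap.add_apply, LinearMap.smul_apply, smul_eq_mul, hpp,
        hpu, hpw, huu, huw, hww, hsymm u p, hsymm w p, hsymm w u] at this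
      linear_combination this
    have hγ : γ ≠ 0 := by
      rintro rfl
      have ht : t = 0 := by simpa using h1.symm
      have hα : α ≠ 0 := by
        rintro rfl
        exact hv i (by rw [hx, ht]; simp)
      apply hp'
      have := hi'.2
      rw [hx, ht, zero_smul, zero_smul, add_zero, add_zero, hβ'] at this
      rw [hβ']
      simpa [hα] using this
    refine ⟨t / γ, γ, hγ, ?_⟩
    rw [hx, smul_add, smul_add, smul_smul, smul_smul]
    congr 3
    · field_simp; linear_combination h1
    · field_simp
  choose! t γ hγ hvt using hpoint
  have hmult : ∀ i, meetOrder q q' (v i) ≠ 0 →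
      meetOrder q q' (v i) ≤ G.roots.count (t i) := by
    intro i hi
    have hi' : eval (v i) q = 0 ∧ eval (v i) q' = 0 := by
      by_contra hcon
      exact hi (if_neg hcon)
    have hroot : G.IsRoot (t i) := by
      have := hi'.2
      rw [hvt i hi, hβ'] at this
      simp only [map_smul, LinearMap.smul_apply, smul_eq_mul, mul_eq_zero, hγ i hi, false_or]
        at this
      simp only [map_add, map_smul, LinearMap.add_apply, LinearMap.smul_apply, smul_eq_mul,
        hsymm' u p, hsymm' w p, hsymm' w u] at this
      rw [Polynomial.IsRoot.def, hG]
      simp only [Polynomial.eval_add, Polynomial.eval_mul, Polynomial.eval_C, Polynomial.eval_pow,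
        Polynomial.eval_X]
      linear_combination this
    rw [Polynomial.count_roots]
    rw [meetOrder, if_pos hi']
    split_ifs with htan
    · obtain ⟨c, hc⟩ := htan
      refine (Polynomial.one_lt_rootMultiplicity_iff_isRoot hGne).2 ⟨hroot, ?_⟩
      have hcβ : ∀ y, β' (v i) y = c * β (v i) y := by
        intro y
        apply mul_left_cancel₀ (two_ne_zero (α := ℂ))
        rw [← hd', mul_left_comm, ← hd, Finset.mul_sum]
        exact Finset.sum_congr rfl fun j _ => by rw [hc]; ring
      -- The velocity vector of the parametrization is tangent to the first conic. Proportional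
      -- gradients make it tangent to the second as well, so the derivative of G vanishes and the
      -- root is multiple.
      have h := hcβ ((2 * t i) • p + u)
      have h0 : β (v i) ((2 * t i) • p + u) = 0 := by
        rw [hvt i hi]
        simp only [map_add, map_smul, LinearMap.add_apply, LinearMap.smul_apply, smul_eq_mul, hpp,
          hpu, hpw, huu, huw, hsymm u p, hsymm w p, hsymm w u]
        ring
      rw [h0, mul_zero, hvt i hi] at h
      simp only [map_smul, LinearMap.smul_apply, smul_eq_mul, mul_eq_zero, hγ i hi, false_or] at h
      simp only [map_add, map_smul, LinearMap.add_apply, LinearMap.smul_apply, smul_eq_mul,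
        hsymm' u p, hsymm' w p, hsymm' w u] at h
      rw [Polynomial.IsRoot.def, hG]
      simp only [Polynomial.derivative_add, Polynomial.derivative_mul, Polynomial.derivative_C,
        Polynomial.derivative_X_pow, Polynomial.derivative_X, Polynomial.eval_add,
        Polynomial.eval_mul, Polynomial.eval_C, Polynomial.eval_pow, Polynomial.eval_X,
        Polynomial.eval_zero, Polynomial.eval_one]
      norm_num
      linear_combination 2 * h
    · exact (Polynomial.rootMultiplicity_pos hGne).2 hroot
  have hinjt : Set.InjOn t (s.filter fun i => meetOrder q q' (v i) ≠ 0) := by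
    intro i hi j hj hij
    rw [Finset.mem_coe, Finset.mem_filter] at hi hj
    refine hinj i j (γ i / γ j) ?_
    rw [hvt i hi.2, hvt j hj.2, hij, smul_smul, div_mul_cancel₀ _ (hγ j hj.2)]
  calc ∑ i ∈ s, meetOrder q q' (v i)
      = ∑ i ∈ s with meetOrder q q' (v i) ≠ 0, meetOrder q q' (v i) :=
        (Finset.sum_filter_ne_zero s).symm
    _ ≤ ∑ i ∈ s with meetOrder q q' (v i) ≠ 0, G.roots.count (t i) :=
        Finset.sum_le_sum fun i hi => hmult i (Finset.mem_filter.1 hi).2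
    _ = ∑ z ∈ (s.filter fun i => meetOrder q q' (v i) ≠ 0).image t, G.roots.count z :=
        (Finset.sum_image (f := fun z => G.roots.count z) hinjt).symm
    _ ≤ Multiset.card G.roots := by
        rw [← Multiset.sum_count_eq_card (s := (s.filter fun i => meetOrder q q' (v i) ≠ 0).image t ∪
          G.roots.toFinset) (fun a ha => Finset.mem_union_right _ (Multiset.mem_toFinset.2 ha))]
        exact Finset.sum_le_sum_of_subset Finset.subset_union_left
    _ ≤ G.natDegree := G.card_roots'
    _ ≤ 4 := hGdeg

end Conics

/-! ### Local comparison of Tjurina numbers with contact, and the global sum. -/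

section Arrangements

theorem IsSingularPoint.smul {f : MvPolynomial (Fin 3) ℂ} {d : ℕ} (hf : f.IsHomogeneous d)
    {v : Fin 3 → ℂ} (h : IsSingularPoint f v) {c : ℂ} (hc : c ≠ 0) : IsSingularPoint f (c • v) :=
  ⟨smul_ne_zero hc h.1, by rw [eval_smul_of_isHomogeneous hf, h.2.1, mul_zero],
    fun i => by rw [eval_smul_of_isHomogeneous hf.pderiv, h.2.2 i, mul_zero]⟩

theorem eq_zero_of_sum_mul_eq_zero {a b v : Fin 3 → ℂ} (hli : LinearIndependent ℂ ![a, b, v])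
    {g : Fin 3 → ℂ} (ha : ∑ j, g j * a j = 0) (hb : ∑ j, g j * b j = 0)
    (hv : ∑ j, g j * v j = 0) (i : Fin 3) : g i = 0 := by
  obtain ⟨α, t, γ, h⟩ := exists_eq_combination hli (Pi.single i 1)
  have h1 : ∑ j, g j * (Pi.single i 1 : Fin 3 → ℂ) j = g i := by simp [Pi.single_apply]
  rw [← h1, h]
  simp only [Fin.sum_univ_three, Pi.add_apply, Pi.smul_apply, smul_eq_mul] at ha hb hv ⊢
  linear_combination α * ha + t * hb + γ * hv

theorem constantCoeff_pderiv_germHom (v a b : Fin 3 → ℂ) (f : MvPolynomial (Fin 3) ℂ) (i : Fin 2) :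
    MvPowerSeries.constantCoeff (MvPowerSeries.pderiv ℂ i (germHom v a b f)) =
      ∑ j, eval v (pderiv j f) * ![a, b] i j := by
  rw [pderiv_germHom, map_sum]
  simp [constantCoeff_germHom]

theorem sum_eval_pderiv_mul {f : MvPolynomial (Fin 3) ℂ} {d : ℕ} (hf : f.IsHomogeneous d)
    {v : Fin 3 → ℂ} (hv : eval v f = 0) : ∑ j, eval v (pderiv j f) * v j = 0 := by
  have := congrArg (eval v) hf.sum_X_mul_pderiv
  simp only [map_sum, map_mul, eval_X, nsmul_eq_mul, hv, mul_zero] at this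
  rw [← this]
  exact Finset.sum_congr rfl fun j _ => mul_comm _ _

/-- The germ's partials at the origin are the gradient paired with a and b; Euler's relation kills
the pairing with v. If all three vanished, so would the gradient. -/
theorem IsSmoothConic.exists_constantCoeff_pderiv_ne_zero {q : MvPolynomial (Fin 3) ℂ}
    (hq : IsSmoothConic q) {v a b : Fin 3 → ℂ} (hli : LinearIndependent ℂ ![a, b, v])
    (hv : eval v q = 0) :
    ∃ i, MvPowerSeries.constantCoeff (MvPowerSeries.pderiv ℂ i (germHom v a b q)) ≠ 0 := by
  by_contra! hc
  simp only [constantCoeff_pderiv_germHom] at hc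
  exact hq.2 v ⟨hli.ne_zero 2, hv, eq_zero_of_sum_mul_eq_zero hli (hc 0) (hc 1)
    (sum_eval_pderiv_mul hq.1 hv)⟩

theorem IsSmoothConic.order_germHom_le {q : MvPolynomial (Fin 3) ℂ} (hq : IsSmoothConic q)
    {v a b : Fin 3 → ℂ} (hli : LinearIndependent ℂ ![a, b, v]) :
    (germHom v a b q).order ≤ if eval v q = 0 then 1 else 0 := by
  split_ifs with hv
  · obtain ⟨i, hi⟩ := hq.exists_constantCoeff_pderiv_ne_zero hli hv
    rw [← MvPowerSeries.coeff_zero_eq_constantCoeff_apply, MvPowerSeries.coeff_pderiv] at hi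
    refine (MvPowerSeries.order_le (left_ne_zero_of_mul hi)).trans ?_
    simp
  · have h : MvPowerSeries.coeff 0 (germHom v a b q) ≠ 0 := by
      rw [MvPowerSeries.coeff_zero_eq_constantCoeff_apply, constantCoeff_germHom]
      exact hv
    refine (MvPowerSeries.order_le h).trans ?_
    simp

/-- A vanishing Jacobian makes the two affine gradients proportional, the first being nonzero. By
Euler's relation the proportionality extends to the full gradients. -/
theorem meetOrder_eq_two_of_germJacobian_eq_zero {q q' : MvPolynomial (Fin 3) ℂ}
    (hq : IsSmoothConic q) (hq' : q'.IsHomogeneous 2) {v a b : Fin 3 → ℂ}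
    (hli : LinearIndependent ℂ ![a, b, v]) (hv : eval v q = 0) (hv' : eval v q' = 0)
    (h : germJacobian (germHom v a b q) (germHom v a b q') = 0) : meetOrder q q' v = 2 := by
  rw [meetOrder, if_pos ⟨hv, hv'⟩, if_pos]
  obtain ⟨i, hi⟩ := hq.exists_constantCoeff_pderiv_ne_zero hli hv
  obtain ⟨c, hc⟩ : ∃ c, ∀ i, MvPowerSeries.constantCoeff
      (MvPowerSeries.pderiv ℂ i (germHom v a b q')) = c * MvPowerSeries.constantCoeff
      (MvPowerSeries.pderiv ℂ i (germHom v a b q)) := by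
    refine ⟨MvPowerSeries.constantCoeff (MvPowerSeries.pderiv ℂ i (germHom v a b q')) /
      MvPowerSeries.constantCoeff (MvPowerSeries.pderiv ℂ i (germHom v a b q)), fun j => ?_⟩
    rw [div_mul_eq_mul_div, eq_div_iff hi]
    rw [germJacobian] at h
    fin_cases i <;> fin_cases j <;> dsimp only [Fin.zero_eta, Fin.mk_one] <;>
      first | ring1 | linear_combination h | linear_combination -h
  simp only [constantCoeff_pderiv_germHom] at hc
  refine ⟨c, fun l => sub_eq_zero.1 (eq_zero_of_sum_mul_eq_zero
    (g := fun l => eval v (pderiv l q') - c * eval v (pderiv l q)) hli ?_ ?_ ?_ l)⟩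
  · have : ∑ j, eval v (pderiv j q') * a j = c * ∑ j, eval v (pderiv j q) * a j := hc 0
    simp only [sub_mul, Finset.sum_sub_distrib, this, Finset.mul_sum, mul_assoc, sub_self]
  · have : ∑ j, eval v (pderiv j q') * b j = c * ∑ j, eval v (pderiv j q) * b j := hc 1
    simp only [sub_mul, Finset.sum_sub_distrib, this, Finset.mul_sum, mul_assoc, sub_self]
  · simp only [sub_mul, Finset.sum_sub_distrib, sum_eval_pderiv_mul hq' hv', mul_assoc,
      ← Finset.mul_sum, sum_eval_pderiv_mul hq.1 hv, mul_zero, sub_self]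

theorem HasSmoothBranches.order_eq {F : MvPowerSeries (Fin 2) ℂ} {m μ : ℕ}
    (h : HasSmoothBranches F m μ) : F.order = m := by
  obtain ⟨g, rfl, ho, -⟩ := h
  rw [MvPowerSeries.order_prod]
  simp [ho]

theorem one_le_meetOrder {q q' : MvPolynomial (Fin 3) ℂ} {v : Fin 3 → ℂ} (h : eval v q = 0)
    (h' : eval v q' = 0) : 1 ≤ meetOrder q q' v := by
  rw [meetOrder, if_pos ⟨h, h'⟩]
  split_ifs <;> omega

/-- The sum of the truncated contact orders of all ordered pairs of distinct conics at a point. -/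
noncomputable def totalContact {k : ℕ} (Q : Fin k → MvPolynomial (Fin 3) ℂ) (v : Fin 3 → ℂ) : ℕ :=
  ∑ x ∈ (Finset.univ : Finset (Fin k)).offDiag, meetOrder (Q x.1) (Q x.2) v

variable {k : ℕ} {Q : Fin k → MvPolynomial (Fin 3) ℂ}

/-- Each conic contributes at most one to the order of the product, so a point of multiplicity m
lies on at least m conics, and every ordered pair of them contributes at least one to the contact.
No matching of the given branches with the conics is needed. -/
theorem exists_finset_of_order_eq (hQ : ∀ i, IsSmoothConic (Q i)) {v a b : Fin 3 → ℂ}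
    (hli : LinearIndependent ℂ ![a, b, v]) {m : ℕ}
    (hm : (germHom v a b (∏ i, Q i)).order = m) :
    ∃ s : Finset (Fin k), (∀ i, i ∈ s ↔ eval v (Q i) = 0) ∧ m ≤ s.card ∧
      s.card * s.card - s.card ≤ totalContact Q v := by
  classical
  refine ⟨Finset.univ.filter fun i => eval v (Q i) = 0, by simp, ?_, ?_⟩
  · have h : (m : ℕ∞) ≤ ∑ i, if eval v (Q i) = 0 then 1 else 0 := by
      rw [← hm, map_prod, MvPowerSeries.order_prod]
      exact Finset.sum_le_sum fun i _ => (hQ i).order_germHom_le hli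
    rw [Finset.sum_boole] at h
    exact_mod_cast h
  · rw [← Finset.offDiag_card, Finset.card_eq_sum_ones]
    refine (Finset.sum_le_sum fun x hx => ?_).trans
      (Finset.sum_le_sum_of_subset (Finset.offDiag_mono (Finset.filter_subset _ _)))
    simp only [Finset.mem_offDiag, Finset.mem_filter] at hx
    exact one_le_meetOrder hx.1.2 hx.2.1.2

/-- The abstract branches are never identified with the conics; the cases are split by what the
conics do. Two tangent conics give contact 4 against τ ≤ 3, while the remaining configurations
satisfy the inequality without having to be excluded. -/
theorem exists_colength_of_tacnode (hQ : ∀ i, IsSmoothConic (Q i)) {d : ℕ} (hd : d ≠ 0)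
    (hf : (∏ i, Q i).IsHomogeneous d) {v a b : Fin 3 → ℂ}
    (hli : LinearIndependent ℂ ![a, b, v])
    (hF : HasSmoothBranches (germHom v a b (∏ i, Q i)) 2 2) :
    ∃ τ, HasColengthLE ((jacobianIdeal (∏ i, Q i)).map (germHom v a b)) τ ∧
      4 * τ ≤ 3 * totalContact Q v ∧ 0 < totalContact Q v := by
  classical
  obtain ⟨s, hs, hms, hsc⟩ := exists_finset_of_order_eq hQ hli hF.order_eq
  have h3 := hF.colength_tacnode (Ideal.mem_map_of_mem (germHom v a b) (mem_jacobianIdeal hd hf))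
    (pderiv_germHom_mem v a b)
  rcases hms.lt_or_eq with hlt | heq
  -- Three or more conics through the point already give contact at least 6, ample for τ ≤ 3.
  · have : 6 ≤ s.card * s.card - s.card := by
      rw [← Nat.mul_sub_one]
      exact Nat.mul_le_mul hlt (Nat.sub_le_sub_right hlt 1)
    exact ⟨3, h3, by omega, by omega⟩
  · rw [← heq] at hsc
    obtain ⟨i, j, hij, rfl⟩ := Finset.card_eq_two.1 heq.symm
    have hi : eval v (Q i) = 0 := (hs i).1 (by simp)
    have hj : eval v (Q j) = 0 := (hs j).1 (by simp)
    by_cases hjac : germJacobian (germHom v a b (Q i)) (germHom v a b (Q j)) = 0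
    · refine ⟨3, h3, ?_⟩
      have hjac' : germJacobian (germHom v a b (Q j)) (germHom v a b (Q i)) = 0 := by
        rw [germJacobian] at hjac ⊢
        linear_combination -hjac
      have : 4 ≤ totalContact Q v := by
        have hsub : ({(i, j), (j, i)} : Finset (Fin k × Fin k)) ⊆ Finset.univ.offDiag := by
          intro x hx
          simp only [Finset.mem_insert, Finset.mem_singleton] at hx
          rcases hx with rfl | rfl <;> simp [hij, hij.symm]
        refine le_trans ?_ (Finset.sum_le_sum_of_subset hsub)
        rw [Finset.sum_pair (by simp [hij]),
          meetOrder_eq_two_of_germJacobian_eq_zero (hQ i) (hQ j).1 hli hi hj hjac,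
          meetOrder_eq_two_of_germJacobian_eq_zero (hQ j) (hQ i).1 hli hj hi hjac']
      omega
    -- If the two conics are transversal, the others are units at the point and can be absorbed into
    -- one factor. The germ is then a node, with τ ≤ 1 against contact at least 2.
    · refine ⟨1, ?_, by omega, by omega⟩
      set r := ∏ l ∈ Finset.univ \ {i, j}, germHom v a b (Q l) with hr
      have hprod : germHom v a b (∏ l, Q l) =
          (r * germHom v a b (Q i)) * germHom v a b (Q j) := by
        rw [map_prod, ← Finset.prod_sdiff (Finset.subset_univ {i, j}), Finset.prod_pair hij,
          mul_assoc]
      have hr0 : MvPowerSeries.constantCoeff r ≠ 0 := by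
        rw [hr, map_prod, Finset.prod_ne_zero_iff]
        intro l hl
        rw [constantCoeff_germHom]
        intro h0
        exact (Finset.mem_sdiff.1 hl).2 ((hs l).2 h0)
      refine hasColengthLE_of_germJacobian_ne_zero (x := r * germHom v a b (Q i))
        (y := germHom v a b (Q j)) (by rw [map_mul, constantCoeff_germHom, hi, mul_zero])
        (by rw [constantCoeff_germHom, hj]) ?_ (hprod ▸ pderiv_germHom_mem v a b)
      have := germJacobian_combination (g := germHom v a b (Q i)) (h := germHom v a b (Q j))
        (by rw [constantCoeff_germHom, hi]) (by rw [constantCoeff_germHom, hj]) r 0 0 1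
      rw [zero_mul, zero_mul, one_mul, add_zero, zero_add, mul_one, zero_mul, sub_zero] at this
      rw [this]
      exact mul_ne_zero hr0 hjac

/-- At each singular point of the arrangement, the Tjurina number is at most three quarters of the
total contact of the conics. -/
theorem IsQConicArrangement.exists_colength (hQ : IsQConicArrangement Q) {d : ℕ} (hd : d ≠ 0)
    (hf : (∏ i, Q i).IsHomogeneous d) {v : Fin 3 → ℂ} (hv : IsSingularPoint (∏ i, Q i) v) :
    ∃ a b, LinearIndependent ℂ ![a, b, v] ∧
      ∃ τ, HasColengthLE ((jacobianIdeal (∏ i, Q i)).map (germHom v a b)) τ ∧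
        4 * τ ≤ 3 * totalContact Q v ∧ 0 < totalContact Q v := by
  have hbound : ∀ {s m : ℕ}, m ≤ s → m * m - m ≤ s * s - s := by
    intro s m h
    rw [← Nat.mul_sub_one, ← Nat.mul_sub_one]
    exact Nat.mul_le_mul h (Nat.sub_le_sub_right h 1)
  rcases hQ.singularities v hv with ⟨a, b, hli, h⟩ | ⟨a, b, hli, h⟩ | ⟨a, b, hli, h⟩ | ⟨a, b, hli, h⟩
  all_goals rw [← germHom_apply] at h
  · obtain ⟨s, -, hms, hsc⟩ := exists_finset_of_order_eq hQ.smooth hli h.order_eq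
    have := hbound hms
    exact ⟨a, b, hli, 1, h.colength_node (pderiv_germHom_mem v a b), by omega, by omega⟩
  · exact ⟨a, b, hli, exists_colength_of_tacnode hQ.smooth hd hf hli h⟩
  · obtain ⟨s, -, hms, hsc⟩ := exists_finset_of_order_eq hQ.smooth hli h.order_eq
    have := hbound hms
    exact ⟨a, b, hli, 4, h.colength_triplePoint (pderiv_germHom_mem v a b), by omega, by omega⟩
  · obtain ⟨s, -, hms, hsc⟩ := exists_finset_of_order_eq hQ.smooth hli h.order_eq
    have := hbound hms
    exact ⟨a, b, hli, 9, h.colength_quadruplePoint (pderiv_germHom_mem v a b), by omega, by omega⟩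

/-- Exchange the two sums: each of the k(k-1) ordered pairs contributes at most 4 over all points by
Bézout. -/
theorem IsQConicArrangement.sum_totalContact_le (hQ : IsQConicArrangement Q)
    (s : Finset (Projectivization ℂ (Fin 3 → ℂ))) : ∑ p ∈ s, totalContact Q p.rep ≤ (k * k - k) * 4 := by
  simp only [totalContact]
  rw [Finset.sum_comm]
  have hcard : (Finset.univ : Finset (Fin k)).offDiag.card = k * k - k := by
    rw [Finset.offDiag_card, Finset.card_univ, Fintype.card_fin]
  rw [← hcard, ← smul_eq_mul]
  refine Finset.sum_le_card_nsmul _ _ _ fun x hx => ?_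
  refine sum_meetOrder_le (hQ.smooth _) (hQ.smooth _)
    (hQ.distinct _ _ (Finset.mem_offDiag.1 hx).2.2) s (fun p => p.rep) (fun p => p.rep_nonzero)
    fun p p' c hc => ?_
  rw [← p.mk_rep, ← p'.mk_rep, Projectivization.mk_eq_mk_iff']
  exact ⟨c, hc.symm⟩

end Arrangements

/-! ### Conclusion: the two bounds contradict each other. -/

theorem theoremA (k : ℕ) (Q : Fin k → MvPolynomial (Fin 3) ℂ) (hQ : IsQConicArrangement Q) :
    ¬ IsFreeCurve (∏ i, Q i) := by
  intro hfree
  obtain ⟨m, rfl⟩ : ∃ m, k = m + 2 := ⟨k - 2, by have := hQ.two_le; omega⟩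
  have hf : (∏ i, Q i).IsHomogeneous (2 * m + 4) := by
    have := IsHomogeneous.prod Finset.univ Q (fun _ => 2) fun i _ => (hQ.smooth i).1
    rw [Finset.sum_const, Finset.card_univ, Fintype.card_fin, smul_eq_mul] at this
    convert this using 1
    ring
  have hloc := fun v => hQ.exists_colength (v := v) (by omega) hf
  set S : Set (Projectivization ℂ (Fin 3 → ℂ)) := {p | IsSingularPoint (∏ i, Q i) p.rep} with hS
  -- Each singular point has contact at least one, and the total contact is bounded, so there are
  -- finitely many.
  have hfin : S.Finite := by
    by_contra hinf
    obtain ⟨t, htS, ht⟩ := Set.Infinite.exists_subset_card_eq hinf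
      (((m + 2) * (m + 2) - (m + 2)) * 4 + 1)
    have h1 := hQ.sum_totalContact_le t
    have h2 : t.card ≤ ∑ p ∈ t, totalContact Q p.rep := by
      rw [Finset.card_eq_sum_ones]
      refine Finset.sum_le_sum fun p hp => ?_
      obtain ⟨a, b, -, τ, -, -, hpos⟩ := hloc _ (htS hp)
      exact hpos
    omega
  have := hfin.fintype
  choose a b hli τ hτ hle _ using fun p : S => hloc p.1.rep p.2
  have hlt := lt_sum_colength_of_isFreeCurve hf hfree (fun p : S => p.1.rep) a b hli
    (fun w hw => by
      obtain ⟨c, hc⟩ := Projectivization.exists_smul_eq_mk_rep ℂ w hw.1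
      refine ⟨⟨Projectivization.mk ℂ w hw.1, ?_⟩, (c⁻¹ : ℂˣ), Units.ne_zero _, ?_⟩
      · change IsSingularPoint _ _
        rw [← hc]
        exact hw.smul hf c.ne_zero
      · change w = _ • (Projectivization.mk ℂ w hw.1).rep
        rw [← hc, Units.smul_def, smul_smul, Units.inv_mul, one_smul]) τ hτ
  have h1 := hQ.sum_totalContact_le hfin.toFinset
  have h2 : ∑ p : S, totalContact Q p.1.rep = ∑ p ∈ hfin.toFinset, totalContact Q p.rep := by
    exact (Finset.sum_subtype (p := (· ∈ S)) hfin.toFinset (fun p => hfin.mem_toFinset)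
      fun p => totalContact Q p.rep).symm
  have h3 : ∑ p : S, 4 * τ p ≤ ∑ p : S, 3 * totalContact Q p.1.rep :=
    Finset.sum_le_sum fun p _ => hle p
  rw [← Finset.mul_sum, ← Finset.mul_sum, h2] at h3
  have h4 : (m + 2) * (m + 2) - (m + 2) = (m + 2) * (m + 1) := by
    rw [← Nat.mul_sub_one]; rfl
  rw [h4] at h1
  -- Four times the sum of the τ is at most 12(m+2)(m+1), yet freeness makes the sum exceed
  -- 3(m+2)(m+1).
  nlinarith
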